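/- Let $d\ge 1$, equip $\mathbb R^{\mathbb Z^d}$ with the product $\sigma$-algebra, and let $l_0=\{x\in\mathbb R^{\mathbb Z^d}: |x_i|\to 0 \text{ as } |i|\to\infty\}$, $\|x\|=\sup_i|x_i|$, and $(\theta^k x)_i=x_{i+k}$. Definitions. A random field $Y=(Y_i)_{i\in\mathbb Z^d}$ is the tail process of a stationary real random field $X$ if $P(|X_0|>u)>0$ for all $u$, $|Y_0|>1$ a.s., and for every $m$ the law of $(u^{-1}X_i)_{i\in\{-m,\dots,m\}^d}$ conditionally on $|X_0|>u$ converges weakly to the law of $(Y_i)_{i\in\{-m,\dots,m\}^d}$ as $u\to\infty$. A stationary $X$ is regularly varying with tail index $\alpha>0$ if it has a tail process $Y$ and $|Y_0|$ is $\mathrm{Pareto}(\alpha)$-distributed, i.e. $P(|Y_0|>y)=y^{-\alpha}$ for $y\ge1$; then $Y$ is said to have tail index $\alpha$, and its spectral tail process is $\Theta=Y/|Y_0|$. Let $e(x)=\{k:|x_k|>1\}$ and $\mathbb E_0=\{x: 0\in e(x),\ |e(x)|<\infty\}$. The (candidate) extremal index of a tail process $Y$ with values in $l_0$ is $\vartheta=E[1/|e(Y)|]$.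 An anchoring function is a measurable $A:\mathbb E_0\to\mathbb Z^d$ with $A(x)\in e(x)$ and $A(\theta^k x)+k=A(x)$ for all $x\in\mathbb E_0$, $k\in e(x)$; the anchored process $Z^A$ has the law of $Y$ conditionally on $A(Y)=0$, and $Q^A=Z^A/\|Z^A\|$. A random element $Q$ of $l_0$ is a representative of the anchored spectral tail process of $Y$ if $E[h(Q)]=E[h(Q^A)]$ for all measurable $h:l_0\to[0,\infty)$ with $h\circ\theta^k=h$ for all $k$, for at least one, and then for every, anchoring function $A$. Proposition. Let $C=(C_i)_{i\in\mathbb Z^d}$ be a random element of $l_0$ and $\alpha>0$ such that $$c:=\sum_{k\in\mathbb Z^d}E\big[|C_k|^\alpha\big]\in(0,\infty),$$ and let $\kappa$ be a $\{-1,1\}$-valued random variable independent of $C$. Consider, for a random element $\Theta$ of $l_0$, the relation $$E[h(\Theta)]=\frac1c\,E\Big[\sum_{k\in\mathbb Z^d}h\Big(\frac{\kappa\,\theta^kC}{|C_k|}\Big)|C_k|^\alpha\Big]\quad\text{for all measurable }h:l_0\to[0,\infty),\qquad(*)$$ where the $k$th summand is $0$ if $C_k=0$. (i) If $\Theta$ is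 a random element of $l_0$ satisfying $(*)$, then $\Theta$ is (in law) the spectral tail process of some stationary regularly varying random field with tail index $\alpha$. (ii) Let $Y$ be a tail process, with values in $l_0$, of some stationary regularly varying random field with tail index $\alpha$, and suppose that its spectral tail process $\Theta$ satisfies $(*)$. Then every random element $Q$ of $l_0$ with distribution $$P(Q\in\cdot)=\frac{1}{E[\|C\|^\alpha]}\,E\Big[\mathbf 1\Big\{\frac{\kappa\,C}{\|C\|}\in\cdot\Big\}\|C\|^\alpha\Big]$$ is a representative of the anchored spectral tail process of $Y$, and the extremal index of $Y$ is $$\vartheta=\frac{E[\|C\|^\alpha]}{\sum_{k\in\mathbb Z^d}E[|C_k|^\alpha]}.$$ -/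

import Mathlib

open MeasureTheory ProbabilityTheory Filter Topology
open scoped ENNReal NNReal BoundedContinuousFunction

namespace TailField

/-- The index set `ℤ^d`. -/
abbrev Lattice (d : ℕ) : Type := Fin d → ℤ

/-- The space `ℝ^{ℤ^d}`, with the product topology and the product `σ`-algebra. -/
abbrev Path (d : ℕ) : Type := Lattice d → ℝ

/-- The shift `(θ^k x)_i = x_{i+k}`, moving the origin to `k`. -/
def shift {d : ℕ} (k : Lattice d) (x : Path d) : Path d := fun i => x (i + k)

/-- A function is shift-invariant on `B`. -/
def ShiftInvariantOn {d : ℕ} {β : Type*} (h : Path d → β) (B : Set (Path d)) : Prop :=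
  ∀ x ∈ B, ∀ k : Lattice d, h (shift k x) = h x

/-- The space `l₀` of fields vanishing at infinity. Balls of `ℤ^d` are finite, so `|i| → ∞` is
convergence along the cofinite filter. -/
def l0 (d : ℕ) : Set (Path d) := {x | Tendsto (fun i => |x i|) cofinite (𝓝 0)}

/-- The uniform norm `‖x‖ = sup_i |x_i|`, used for `x ∈ l₀` only (where the supremum is finite). -/
noncomputable def supNorm {d : ℕ} (x : Path d) : ℝ := ⨆ i, |x i|

/-- The set `e(x)` of exceedance points. -/
def exceedances {d : ℕ} (x : Path d) : Set (Lattice d) := {k | 1 < |x k|}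

/-- The space `𝔼₀`: an exceedance point at the origin, and finitely many exceedance points. -/
def E0 (d : ℕ) : Set (Path d) := {x | 0 ∈ exceedances x ∧ (exceedances x).Finite}

/-! ### Tail processes (in terms of the laws of the random fields on `ℝ^{ℤ^d}`) -/

/-- Strict stationarity of a random field with law `μ`. -/
def IsStationary {d : ℕ} (μ : Measure (Path d)) : Prop :=
  ∀ k : Lattice d, μ.map (shift k) = μ

/-- The hypercube `{-m,…,m}^d`. -/
def box (d m : ℕ) : Set (Lattice d) := {i | ∀ j, |i j| ≤ (m : ℤ)}

/-- A random field `Y` with law `μY` is the tail process of a random field `X` with law `μX`: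
`|Y_0| > 1` a.s., and for every `m` the law of `(u⁻¹ X_i)_{i ∈ {-m,…,m}^d}` conditionally on
`|X_0| > u` converges weakly to the law of `(Y_i)_{i ∈ {-m,…,m}^d}` as `u → ∞`. -/
structure IsTailProcessOf {d : ℕ} (μX μY : Measure (Path d)) : Prop where
  tail_pos : ∀ u : ℝ, 0 < μX {x | u < |x 0|}
  exceeds : ∀ᵐ y ∂μY, 1 < |y 0|
  tendsto : ∀ (m : ℕ) (f : (box d m → ℝ) →ᵇ ℝ),
    Tendsto (fun u : ℝ => ∫ x, f (fun i => u⁻¹ * x i) ∂(cond μX {x | u < |x 0|}))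
      atTop (𝓝 (∫ y, f (fun i => y i) ∂μY))

/-- `μY` is the law of the tail process of some stationary regularly varying random field with
tail index `α`. Regular variation of the stationary field is the existence of its tail process
`Y`, and the tail index is the `α` for which `|Y_0|` is `Pareto(α)`-distributed. -/
def IsTailProcess {d : ℕ} (α : ℝ) (μY : Measure (Path d)) : Prop :=
  ∃ μX : Measure (Path d), IsProbabilityMeasure μX ∧ IsStationary μX ∧
    IsTailProcessOf μX μY ∧ μY.map (fun y => |y 0|) = paretoMeasure 1 α

/-- `y ↦ y / |y_0|`, which sends a tail process to its spectral tail process. -/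
noncomputable def spectral {d : ℕ} (y : Path d) : Path d := fun i => |y 0|⁻¹ * y i

/-- `μΘ` is the law of the spectral tail process of some stationary regularly varying random
field with tail index `α`. -/
def IsSpectralTailProcess {d : ℕ} (α : ℝ) (μΘ : Measure (Path d)) : Prop :=
  ∃ μY : Measure (Path d), IsProbabilityMeasure μY ∧ IsTailProcess α μY ∧
    μΘ = μY.map spectral

/-- The (candidate) extremal index `ϑ = E[1 / |e(Y)|]` of a tail process `Y` with law `μY`. -/
noncomputable def extremalIndex {d : ℕ} (μY : Measure (Path d)) : ℝ≥0∞ :=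
  ∫⁻ y, ((exceedances y).encard : ℝ≥0∞)⁻¹ ∂μY

/-! ### Anchoring -/

/-- `A` is an anchoring function: a measurable shift-covariant exceedance map on `𝔼₀`
(the values of `A` outside `𝔼₀` are irrelevant). -/
structure IsAnchoring {d : ℕ} (A : Path d → Lattice d) : Prop where
  measurable : Measurable (fun x : E0 d => A x)
  mem : ∀ x ∈ E0 d, A x ∈ exceedances x
  covariant : ∀ x ∈ E0 d, ∀ k ∈ exceedances x, A (shift k x) + k = A x

/-- The law of the anchored tail process `Z^A`: the law of `Y` conditionally on `A(Y) = 0`. -/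
noncomputable def anchoredLaw {d : ℕ} (A : Path d → Lattice d) (μY : Measure (Path d)) :
    Measure (Path d) :=
  cond μY {y | y ∈ E0 d ∧ A y = 0}

/-- `E[h(Q)] = E[h(Q^A)]`, with `Q^A = Z^A / ‖Z^A‖`, for all measurable shift-invariant
`h : l₀ → ℝ₊`. -/
def RepresentsAnchor {d : ℕ} (A : Path d → Lattice d) (μY μQ : Measure (Path d)) : Prop :=
  ∀ h : Path d → ℝ≥0, Measurable h → ShiftInvariantOn h (l0 d) →
    ∫⁻ q, (h q : ℝ≥0∞) ∂μQ = ∫⁻ z, (h ((supNorm z)⁻¹ • z) : ℝ≥0∞) ∂(anchoredLaw A μY)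

/-- A random element `Q` of `l₀` with law `μQ` is a representative of the anchored spectral tail
process of `Y` (with law `μY`): the above holds for at least one, and for every, anchoring
function. -/
structure IsAnchoredSpectralRepresentative {d : ℕ} (μY μQ : Measure (Path d)) : Prop where
  mem_l0 : ∀ᵐ q ∂μQ, q ∈ l0 d
  exists_anchor : ∃ A : Path d → Lattice d, IsAnchoring A ∧ RepresentsAnchor A μY μQ
  forall_anchor : ∀ A : Path d → Lattice d, IsAnchoring A → RepresentsAnchor A μY μQ

/-! ### The moving-average formulas -/

/-- `c = ∑_k E|C_k|^α`. -/
noncomputable def coeffMass {d : ℕ} {Ω : Type*} [MeasurableSpace Ω] (P : Measure Ω)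
    (C : Ω → Path d) (α : ℝ) : ℝ≥0∞ :=
  ∑' k, ∫⁻ ω, ENNReal.ofReal (|C ω k| ^ α) ∂P

/-- `E‖C‖^α`. -/
noncomputable def normMoment {d : ℕ} {Ω : Type*} [MeasurableSpace Ω] (P : Measure Ω)
    (C : Ω → Path d) (α : ℝ) : ℝ≥0∞ :=
  ∫⁻ ω, ENNReal.ofReal (supNorm (C ω) ^ α) ∂P

/-- The law `μΘ` satisfies, for all measurable `h ≥ 0`,
`E[h(Θ)] = c⁻¹ E[∑_k h(κ θ^k C / |C_k|) |C_k|^α]`. The `k`-th summand vanishes where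
`C_k = 0`, because `0 ^ α = 0` for `α > 0`. -/
def IsMASpectralLaw {d : ℕ} {Ω : Type*} [MeasurableSpace Ω] (P : Measure Ω)
    (C : Ω → Path d) (κ : Ω → ℝ) (α : ℝ) (μΘ : Measure (Path d)) : Prop :=
  ∀ h : Path d → ℝ≥0, Measurable h →
    ∫⁻ x, (h x : ℝ≥0∞) ∂μΘ =
      (coeffMass P C α)⁻¹ *
        ∫⁻ ω, ∑' k, (h ((κ ω / |C ω k|) • shift k (C ω)) : ℝ≥0∞) *
          ENNReal.ofReal (|C ω k| ^ α) ∂P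

/-- The law `μQ` is
`P(Q ∈ B) = E[1{κ C / ‖C‖ ∈ B} ‖C‖^α] / E‖C‖^α` for measurable `B`. -/
def IsMAAnchoredLaw {d : ℕ} {Ω : Type*} [MeasurableSpace Ω] (P : Measure Ω)
    (C : Ω → Path d) (κ : Ω → ℝ) (α : ℝ) (μQ : Measure (Path d)) : Prop :=
  ∀ B : Set (Path d), MeasurableSet B →
    μQ B = (normMoment P C α)⁻¹ *
      ∫⁻ ω, B.indicator (fun _ => (1 : ℝ≥0∞)) ((κ ω / supNorm (C ω)) • C ω) *
        ENNReal.ofReal (supNorm (C ω) ^ α) ∂P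

end TailField

/-! Let π be the law of κC; since |κ| = 1, the relation (*) and the law of Q depend on (C, κ) only
through π. Everything rests on one infinite measure on paths, the image τ of π ⊗ count ⊗ α r^(-α-1)
dr under (x, k, s) ↦ s θ^k x. It is shift-invariant and homogeneous of order -α. For fixed x and k,
the substitution ρ = s|x_k| turns the condition s|x_k| > 1 into ρ > 1 at the cost of a factor
|x_k|^α. Hence (*) says exactly that τ restricted to {|y_0| > 1} is c times the law of ρΘ, with ρ a
Pareto variable independent of Θ (`restrict_map_cluster`).

For (i), a stationary field with tail measure τ is needed, but τ is infinite. `periodicLaw` keeps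
the radii s > 1, repeats s x periodically with period 2N(s)+1, and lets the base point k run over
one period. Averaging over a full period makes the law stationary. If N(s) → ∞ slowly enough, the
total mass is finite, while periodisation becomes invisible near the origin at high levels, so the
rescaled law converges to τ (`tendsto_periodicLaw`). The tail process is then ρΘ.

For (ii), weak convergence along the levels u and tu shows that the law of Y is homogeneous.
Therefore |Y_0| is independent of Θ, and Y is itself the mixture ρΘ
(`IsTailProcess.eq_paretoMixture`). Expectations of F(Y) thus become integrals over τ, where the sum
over k groups the values of F along an orbit. If that orbit sum is H(z/‖z‖) when ‖z‖ > 1 and 0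
otherwise, then integrating over s leaves c⁻¹ E[H(κC/‖C‖) ‖C‖^α]
(`lintegral_paretoMixture_of_orbit_sum`). The choice F = 1/|e| has H = 1 and gives the extremal
index; F = 1{A = 0} h(·/‖·‖) has H = h and gives the anchored law, because each orbit has exactly
one anchored representative. -/

namespace TailField

/-! ### The radial measure `α r^{-α-1} dr` -/

/-- The density of the radial measure. -/
noncomputable def radialDensity (α r : ℝ) : ℝ≥0∞ :=
  (Set.Ioi (0 : ℝ)).indicator (fun r => ENNReal.ofReal (α * r ^ (-(α + 1)))) r

/-- The measure `α r^{-α-1} dr` on `(0, ∞)`. -/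
noncomputable def radial (α : ℝ) : Measure ℝ := volume.withDensity (radialDensity α)

instance (α : ℝ) : SFinite (radial α) := by unfold radial; infer_instance

lemma measurable_radialDensity (α : ℝ) : Measurable (radialDensity α) :=
  Measurable.indicator (by fun_prop) measurableSet_Ioi

lemma radialDensity_mul {α a : ℝ} (ha : 0 < a) (s : ℝ) :
    radialDensity α (a * s) = ENNReal.ofReal (a ^ (-(α + 1))) * radialDensity α s := by
  unfold radialDensity
  by_cases hs : 0 < s
  · rw [Set.indicator_of_mem (by simpa using mul_pos ha hs), Set.indicator_of_mem (by simpa using hs),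
      ← ENNReal.ofReal_mul (by positivity), Real.mul_rpow ha.le hs.le]
    ring_nf
  · rw [Set.indicator_of_notMem, Set.indicator_of_notMem (by simpa using hs), mul_zero]
    simpa using mul_nonpos_of_nonneg_of_nonpos ha.le (not_lt.1 hs)

/-- Homogeneity of the radial measure: this scaling produces both the weights |x_k|^α and the
normalisation u^α. -/
lemma lintegral_radial_comp_mul {α a : ℝ} (ha : 0 < a) {g : ℝ → ℝ≥0∞} (hg : Measurable g) :
    ∫⁻ s, g (a * s) ∂(radial α) = ENNReal.ofReal (a ^ α) * ∫⁻ s, g s ∂(radial α) := by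
  have hD := measurable_radialDensity α
  have hm : Measurable fun s : ℝ => a * s := by fun_prop
  have h1 : ∫⁻ s, g s ∂(radial α) =
      ENNReal.ofReal (a ^ (-α)) * ∫⁻ s, g (a * s) ∂(radial α) := by
    have h2 : ∫⁻ s, g (a * s) ∂(radial α) = ∫⁻ s, radialDensity α s * g (a * s) :=
      lintegral_withDensity_eq_lintegral_mul _ hD (hg.comp hm)
    rw [h2, radial, lintegral_withDensity_eq_lintegral_mul _ hD hg]
    conv_lhs => rw [← Real.smul_map_volume_mul_left ha.ne']
    rw [lintegral_smul_measure, lintegral_map (by fun_prop) hm]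
    simp only [Pi.mul_apply, radialDensity_mul ha, mul_assoc]
    rw [lintegral_const_mul _ (by fun_prop), smul_eq_mul, ← mul_assoc, abs_of_pos ha,
      ← ENNReal.ofReal_mul ha.le]
    congr 2
    -- The exponent 1 is the Jacobian of r = a s, and -(α + 1) comes from the density.
    rw [show -α = 1 + -(α + 1) by ring, Real.rpow_add ha, Real.rpow_one]
  rw [h1, ← mul_assoc, ← ENNReal.ofReal_mul (by positivity), ← Real.rpow_add ha]
  simp

lemma setLIntegral_rpow_Ioi {b : ℝ} (hb : 0 < b) {t : ℝ} (ht : 0 < t) :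
    ∫⁻ r in Set.Ioi t, ENNReal.ofReal (b * r ^ (-(b + 1))) = ENNReal.ofReal (t ^ (-b)) := by
  rw [← ofReal_integral_eq_lintegral_ofReal
    ((integrableOn_Ioi_rpow_of_lt (by linarith) ht).const_mul b)]
  · rw [integral_const_mul, integral_Ioi_rpow_of_lt (by linarith) ht]
    congr 1
    rw [show -(b + 1) + 1 = -b by ring]
    field_simp
  · filter_upwards [ae_restrict_mem measurableSet_Ioi] with r hr
    have : 0 < r := ht.trans hr
    simp only [Pi.zero_apply]
    positivity

lemma radial_Ioi {α : ℝ} (hα : 0 < α) {t : ℝ} (ht : 0 < t) :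
    radial α (Set.Ioi t) = ENNReal.ofReal (t ^ (-α)) := by
  rw [radial, withDensity_apply _ measurableSet_Ioi, ← setLIntegral_rpow_Ioi hα ht]
  refine setLIntegral_congr_fun measurableSet_Ioi fun r hr => ?_
  exact Set.indicator_of_mem (ht.trans hr) _

lemma ae_radial_pos (α : ℝ) : ∀ᵐ s ∂(radial α), 0 < s := by
  rw [radial, ae_withDensity_iff (measurable_radialDensity α)]
  refine ae_of_all _ fun s hs => ?_
  by_contra h
  exact hs (Set.indicator_of_notMem (by simpa using h) _)

lemma paretoMeasure_eq (α : ℝ) : paretoMeasure 1 α = (radial α).restrict (Set.Ioi 1) := by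
  have h : (radial α).restrict (Set.Ioi 1) = (radial α).restrict (Set.Ici 1) :=
    Measure.restrict_congr_set ((withDensity_absolutelyContinuous volume _).ae_le Ioi_ae_eq_Ici)
  rw [h, radial, restrict_withDensity measurableSet_Ici, paretoMeasure,
    ← withDensity_indicator measurableSet_Ici]
  congr 1
  ext r
  by_cases hr : 1 ≤ r
  · rw [Set.indicator_of_mem (by simpa using hr), paretoPDF_of_le hr]
    simp [radialDensity, zero_lt_one.trans_le hr]
  · rw [Set.indicator_of_notMem (by simpa using hr), paretoPDF_of_lt (not_le.1 hr)]

/-! ### Clusters -/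

variable {d : ℕ}

@[fun_prop]
lemma measurable_shift (k : Lattice d) : Measurable (shift k : Path d → Path d) := by
  unfold shift; fun_prop

/-- `(x, k, s) ↦ s θ^k x`. -/
def cluster (p : Path d × Lattice d × ℝ) : Path d := p.2.2 • shift p.2.1 p.1

@[fun_prop]
lemma measurable_eval : Measurable fun p : Path d × Lattice d => p.1 p.2 :=
  measurable_from_prod_countable_left fun i => measurable_pi_apply i

@[fun_prop]
lemma measurable_cluster : Measurable (cluster : Path d × Lattice d × ℝ → Path d) := by
  refine measurable_pi_lambda _ fun i => ?_
  have h : Measurable fun p : Path d × Lattice d × ℝ => p.1 (i + p.2.1) :=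
    measurable_eval.comp (measurable_fst.prodMk (by fun_prop))
  exact (measurable_snd.comp measurable_snd).mul h

@[fun_prop]
lemma measurable_smul_shift (k : Lattice d) :
    Measurable fun x : Path d => |x k|⁻¹ • shift k x := by
  refine measurable_pi_lambda _ fun i => ?_
  simp only [Pi.smul_apply, shift, smul_eq_mul]
  fun_prop

/-- The product measure `π ⊗ count ⊗ α r^{-α-1} dr`. -/
noncomputable def clusterMeasure (π : Measure (Path d)) (α : ℝ) :
    Measure (Path d × Lattice d × ℝ) :=
  π.prod (Measure.count.prod (radial α))

/-- The paths with an exceedance at the origin. -/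
def exceedsAtZero (d : ℕ) : Set (Path d) := {x | 1 < |x 0|}

lemma measurableSet_exceedsAtZero : MeasurableSet (exceedsAtZero d) := by
  unfold exceedsAtZero
  exact measurableSet_lt (by fun_prop) (by fun_prop)

/-- The spectral formula of a moving average, for coefficients with law `π`. -/
def IsSpectralLaw (π : Measure (Path d)) (α : ℝ) (μΘ : Measure (Path d)) : Prop :=
  ∀ h : Path d → ℝ≥0, Measurable h →
    ∫⁻ x, (h x : ℝ≥0∞) ∂μΘ =
      (coeffMass π id α)⁻¹ *
        ∫⁻ x, ∑' k, (h (|x k|⁻¹ • shift k x) : ℝ≥0∞) * ENNReal.ofReal (|x k| ^ α) ∂π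

/-- The law of `ρ Θ` for a Pareto variable `ρ` independent of `Θ`. -/
noncomputable def paretoMixture (α : ℝ) (μΘ : Measure (Path d)) : Measure (Path d) :=
  ((paretoMeasure 1 α).prod μΘ).map fun p => p.1 • p.2

lemma lintegral_clusterMeasure {π : Measure (Path d)} [SFinite π] {α : ℝ}
    {F : Path d × Lattice d × ℝ → ℝ≥0∞} (hF : Measurable F) :
    ∫⁻ p, F p ∂(clusterMeasure π α) = ∫⁻ x, ∑' k, ∫⁻ s, F (x, k, s) ∂(radial α) ∂π := by
  rw [clusterMeasure, lintegral_prod _ hF.aemeasurable]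
  refine lintegral_congr fun x => ?_
  have h : Measurable fun q : Lattice d × ℝ => F (x, q) := hF.comp measurable_prodMk_left
  rw [lintegral_prod _ h.aemeasurable, lintegral_count]

/-- With the radius outside the sum, the range of k may depend on s, and sums over whole orbits
appear. -/
lemma lintegral_clusterMeasure' {π : Measure (Path d)} [SFinite π] {α : ℝ}
    {F : Path d × Lattice d × ℝ → ℝ≥0∞} (hF : Measurable F) :
    ∫⁻ p, F p ∂(clusterMeasure π α) = ∫⁻ x, ∫⁻ s, ∑' k, F (x, k, s) ∂(radial α) ∂π := by
  rw [lintegral_clusterMeasure hF]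
  refine lintegral_congr fun x => (lintegral_tsum fun k => Measurable.aemeasurable ?_).symm
  exact hF.comp (by fun_prop)

/-- Substitute ρ = |x_k| s: the exceedance at the origin becomes ρ > 1, where the radial measure is
the Pareto law. If x_k = 0, both sides vanish because 0 ^ α = 0. -/
lemma lintegral_radial_exceedance {α : ℝ} (hα : 0 < α) {F : Path d → ℝ≥0∞} (hF : Measurable F)
    (x : Path d) (k : Lattice d) :
    ∫⁻ s, (exceedsAtZero d).indicator F (cluster (x, k, s)) ∂(radial α) =
      (∫⁻ ρ, F (ρ • (|x k|⁻¹ • shift k x)) ∂(paretoMeasure 1 α)) *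
        ENNReal.ofReal (|x k| ^ α) := by
  have h0 : ∀ s : ℝ, cluster (x, k, s) 0 = s * x k := fun s => by simp [cluster, shift]
  by_cases hk : x k = 0
  · have : ∀ s, (exceedsAtZero d).indicator F (cluster (x, k, s)) = 0 := fun s =>
      Set.indicator_of_notMem (by simp [exceedsAtZero, h0, hk]) _
    simp [this, hk, Real.zero_rpow hα.ne']
  · have ha : 0 < |x k| := abs_pos.2 hk
    have hg : Measurable fun ρ : ℝ => F (ρ • (|x k|⁻¹ • shift k x)) := by fun_prop
    rw [paretoMeasure_eq, ← lintegral_indicator measurableSet_Ioi, mul_comm,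
      ← lintegral_radial_comp_mul ha (hg.indicator measurableSet_Ioi)]
    refine lintegral_congr_ae ?_
    filter_upwards [ae_radial_pos α] with s hs
    have h1 : cluster (x, k, s) ∈ exceedsAtZero d ↔ |x k| * s ∈ Set.Ioi (1 : ℝ) := by
      simp [exceedsAtZero, h0, abs_mul, abs_of_pos hs, mul_comm]
    by_cases h : |x k| * s ∈ Set.Ioi (1 : ℝ)
    · rw [Set.indicator_of_mem (h1.2 h), Set.indicator_of_mem h, smul_smul]
      rw [show |x k| * s * |x k|⁻¹ = s by field_simp]
      rfl
    · rw [Set.indicator_of_notMem (mt h1.1 h), Set.indicator_of_notMem h]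

lemma lintegral_exceedance_clusterMeasure {π : Measure (Path d)} [SFinite π] {α : ℝ} (hα : 0 < α)
    {F : Path d → ℝ≥0∞} (hF : Measurable F) :
    ∫⁻ p, (exceedsAtZero d).indicator F (cluster p) ∂(clusterMeasure π α) =
      ∫⁻ x, ∑' k, (∫⁻ ρ, F (ρ • (|x k|⁻¹ • shift k x)) ∂(paretoMeasure 1 α)) *
        ENNReal.ofReal (|x k| ^ α) ∂π := by
  have h : Measurable fun p : Path d × Lattice d × ℝ =>
      (exceedsAtZero d).indicator F (cluster p) :=
    (hF.indicator measurableSet_exceedsAtZero).comp measurable_cluster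
  rw [lintegral_clusterMeasure h]
  simp only [lintegral_radial_exceedance hα hF]

lemma measurable_smul_prod : Measurable fun p : ℝ × Path d => p.1 • p.2 := by
  refine measurable_pi_lambda _ fun i => ?_
  simp only [Pi.smul_apply, smul_eq_mul]
  fun_prop

/-- The exceedances of the cluster measure have the law of the Pareto mixture. -/
lemma restrict_map_cluster {π : Measure (Path d)} [SFinite π] {α : ℝ} (hα : 0 < α)
    (hc0 : coeffMass π id α ≠ 0) (hc1 : coeffMass π id α ≠ ∞)
    {μΘ : Measure (Path d)} [SFinite μΘ] (hΘ : IsSpectralLaw π α μΘ) :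
    ((clusterMeasure π α).map cluster).restrict (exceedsAtZero d) =
      coeffMass π id α • paretoMixture α μΘ := by
  have := isProbabilityMeasure_paretoMeasure one_pos hα
  ext B hB
  have hs : MeasurableSet ((fun p : ℝ × Path d => p.1 • p.2) ⁻¹' B) := measurable_smul_prod hB
  have hm : Measurable fun x : Path d => paretoMeasure 1 α {ρ | ρ • x ∈ B} :=
    measurable_measure_prodMk_right hs
  have hfin : ∀ x : Path d, paretoMeasure 1 α {ρ | ρ • x ∈ B} ≠ ∞ := fun x => measure_ne_top _ _
  have hl : paretoMixture α μΘ B = ∫⁻ x, paretoMeasure 1 α {ρ | ρ • x ∈ B} ∂μΘ := by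
    rw [paretoMixture, Measure.map_apply measurable_smul_prod hB, Measure.prod_apply_symm hs]
    rfl
  -- The test function is the probability that ρ x falls in B; it is finite, so passing to `ℝ≥0`
  -- loses nothing.
  have h := hΘ (fun x => (paretoMeasure 1 α {ρ | ρ • x ∈ B}).toNNReal) hm.ennreal_toNNReal
  simp only [ENNReal.coe_toNNReal (hfin _)] at h
  rw [Measure.smul_apply, smul_eq_mul, hl, h, ← mul_assoc, ENNReal.mul_inv_cancel hc0 hc1, one_mul,
    Measure.restrict_apply hB]
  have hE := measurableSet_exceedsAtZero (d := d)
  have h2 := lintegral_exceedance_clusterMeasure (π := π) hα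
    (F := B.indicator 1) (measurable_one.indicator hB)
  have h3 : ∀ y, ∫⁻ ρ, B.indicator (1 : Path d → ℝ≥0∞) (ρ • y) ∂(paretoMeasure 1 α) =
      paretoMeasure 1 α {ρ | ρ • y ∈ B} := fun y =>
    lintegral_indicator_one (measurable_prodMk_right hs)
  simp only [h3] at h2
  rw [← h2, ← lintegral_map ((measurable_one.indicator hB).indicator hE) measurable_cluster,
    lintegral_indicator hE, lintegral_indicator_one hB, Measure.restrict_apply hB]

lemma isProbabilityMeasure_paretoMixture {α : ℝ} (hα : 0 < α) {μΘ : Measure (Path d)}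
    [IsProbabilityMeasure μΘ] : IsProbabilityMeasure (paretoMixture α μΘ) := by
  have := isProbabilityMeasure_paretoMeasure one_pos hα
  exact Measure.isProbabilityMeasure_map measurable_smul_prod.aemeasurable

/-- A moving-average spectral law is carried by paths of modulus one at the origin. -/
lemma IsSpectralLaw.ae_abs_eq_one {π : Measure (Path d)} {α : ℝ} (hα : 0 < α)
    {μΘ : Measure (Path d)} (hΘ : IsSpectralLaw π α μΘ) : ∀ᵐ x ∂μΘ, |x 0| = 1 := by
  have hB : MeasurableSet {x : Path d | |x 0| ≠ 1} :=
    (measurableSet_eq_fun (by fun_prop) (by fun_prop)).compl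
  have h := hΘ ({x | |x 0| ≠ 1}.indicator 1) (measurable_one.indicator hB)
  have h1 : ∀ (x : Path d) (k : Lattice d),
      (({y : Path d | |y 0| ≠ 1}.indicator (1 : Path d → ℝ≥0) (|x k|⁻¹ • shift k x) : ℝ≥0) : ℝ≥0∞)
        * ENNReal.ofReal (|x k| ^ α) = 0 := by
    intro x k
    by_cases hk : x k = 0
    · simp [hk, Real.zero_rpow hα.ne']
    · rw [Set.indicator_of_notMem]
      · simp
      · simp [shift, abs_mul, hk]
  have h2 : ∀ x, (({y : Path d | |y 0| ≠ 1}.indicator (1 : Path d → ℝ≥0) x : ℝ≥0) : ℝ≥0∞) =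
      {y : Path d | |y 0| ≠ 1}.indicator (1 : Path d → ℝ≥0∞) x := fun x => by
    by_cases hx : |x 0| = 1 <;> simp [hx]
  simp only [h1, tsum_zero, lintegral_zero, mul_zero] at h
  simp only [h2] at h
  rw [lintegral_indicator_one hB] at h
  exact h

/-- The moving-average formula only involves the law of `κ C`. -/
lemma coeffMass_map {Ω : Type*} [MeasurableSpace Ω] {P : Measure Ω} {C : Ω → Path d}
    (hC : Measurable C) {κ : Ω → ℝ} (hκ : Measurable κ) (hs : ∀ᵐ ω ∂P, κ ω = -1 ∨ κ ω = 1)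
    (α : ℝ) : coeffMass (P.map fun ω => κ ω • C ω) id α = coeffMass P C α := by
  have hm : Measurable fun ω => κ ω • C ω := by fun_prop
  unfold coeffMass
  refine tsum_congr fun k => ?_
  rw [lintegral_map (by simp only [id]; fun_prop) hm]
  refine lintegral_congr_ae ?_
  filter_upwards [hs] with ω h
  rcases h with h | h <;> simp [h]

/-- The sign is absorbed into the coefficients, as it changes no modulus |C_k|. -/
lemma IsMASpectralLaw.isSpectralLaw {Ω : Type*} [MeasurableSpace Ω] {P : Measure Ω}
    {C : Ω → Path d} (hC : Measurable C) {κ : Ω → ℝ} (hκ : Measurable κ)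
    (hs : ∀ᵐ ω ∂P, κ ω = -1 ∨ κ ω = 1) {α : ℝ} {μΘ : Measure (Path d)}
    (h : IsMASpectralLaw P C κ α μΘ) : IsSpectralLaw (P.map fun ω => κ ω • C ω) α μΘ := by
  intro g hg
  have hm : Measurable fun ω => κ ω • C ω := by fun_prop
  rw [h g hg, coeffMass_map hC hκ hs, lintegral_map (by fun_prop) hm]
  congr 1
  refine lintegral_congr_ae ?_
  filter_upwards [hs] with ω h
  refine tsum_congr fun k => ?_
  have h1 : |(κ ω • C ω) k| = |C ω k| := by rcases h with h | h <;> simp [h]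
  have h2 : (κ ω / |C ω k|) • shift k (C ω) = |C ω k|⁻¹ • shift k (κ ω • C ω) := by
    ext i
    simp only [shift, Pi.smul_apply, smul_eq_mul]
    ring
  rw [h1, h2]

/-! ### Periodisation -/

/-- The cube `{-N,…,N}^d` as a finset. -/
noncomputable def cube (d N : ℕ) : Finset (Lattice d) := Fintype.piFinset fun _ => Finset.Icc (-(N : ℤ)) N

/-- The representative in `{-N,…,N}^d` modulo `2N+1`. -/
def fold (N : ℕ) (i : Lattice d) : Lattice d := fun j => (i j).bmod (2 * N + 1)

lemma mem_cube {N : ℕ} {i : Lattice d} : i ∈ cube d N ↔ ∀ j, -(N : ℤ) ≤ i j ∧ i j ≤ N := by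
  simp [cube]

lemma card_cube (N : ℕ) : (cube d N).card = (2 * N + 1) ^ d := by
  have : ((N : ℤ) + 1 + N).toNat = 2 * N + 1 := by omega
  simp [cube, this]

lemma fold_mem (N : ℕ) (i : Lattice d) : fold N i ∈ cube d N := by
  refine mem_cube.2 fun j => ⟨?_, ?_⟩
  · have := Int.le_bmod (x := i j) (m := 2 * N + 1) (by omega)
    simp only [fold]; omega
  · have := Int.bmod_le (x := i j) (m := 2 * N + 1) (by omega)
    simp only [fold]; omega

lemma fold_of_mem {N : ℕ} {i : Lattice d} (h : i ∈ cube d N) : fold N i = i := by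
  funext j
  have := mem_cube.1 h j
  exact Int.bmod_eq_of_le (by omega) (by omega)

lemma fold_fold_add (N : ℕ) (i k : Lattice d) : fold N (i + fold N k) = fold N (i + k) := by
  funext j
  simp [fold]

/-- Translation by j modulo 2N+1 permutes the points of one period. -/
lemma sum_cube_shift {M : Type*} [AddCommMonoid M] (N : ℕ) (j : Lattice d) (f : Lattice d → M) :
    ∑ k ∈ cube d N, f (fold N (k + j)) = ∑ k ∈ cube d N, f k := by
  refine Finset.sum_nbij' (fun k => fold N (k + j)) (fun k => fold N (k - j))
    (fun k _ => fold_mem N _) (fun k _ => fold_mem N _) (fun k hk => ?_) (fun k hk => ?_)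
    (fun k _ => rfl)
  · rw [sub_eq_add_neg, add_comm, fold_fold_add, show -j + (k + j) = k by abel, fold_of_mem hk]
  · rw [add_comm, fold_fold_add, show j + (k - j) = k by abel, fold_of_mem hk]

/-- The periodic field `i ↦ s x_{i + k}`, with period `2 N(s) + 1`. -/
def periodic (N : ℝ → ℕ) (p : Path d × Lattice d × ℝ) : Path d :=
  fun i => p.2.2 * p.1 (fold (N p.2.2) (i + p.2.1))

/-- The parameters with radius above one and base point in one period. -/
def baseSet (d : ℕ) (N : ℝ → ℕ) : Set (Path d × Lattice d × ℝ) :=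
  {p | 1 < p.2.2 ∧ p.2.1 ∈ cube d (N p.2.2)}

lemma measurable_periodic {N : ℝ → ℕ} (hN : Measurable N) :
    Measurable (periodic N : Path d × Lattice d × ℝ → Path d) := by
  refine measurable_pi_lambda _ fun i => ?_
  have h1 : Measurable fun q : ℕ × Lattice d => fold q.1 (i + q.2) := Measurable.of_discrete
  have h2 : Measurable fun p : Path d × Lattice d × ℝ => (N p.2.2, p.2.1) := by fun_prop
  have h : Measurable fun p : Path d × Lattice d × ℝ => p.1 (fold (N p.2.2) (i + p.2.1)) :=
    measurable_eval.comp (measurable_fst.prodMk (h1.comp h2))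
  exact (measurable_snd.comp measurable_snd).mul h

lemma measurableSet_baseSet {N : ℝ → ℕ} (hN : Measurable N) :
    MeasurableSet (baseSet d N) := by
  have h1 : MeasurableSet {q : Lattice d × ℕ | q.1 ∈ cube d q.2} := MeasurableSet.of_discrete
  have hm : Measurable fun p : Path d × Lattice d × ℝ => (p.2.1, N p.2.2) := by fun_prop
  have h2 := hm h1
  have h3 : MeasurableSet {p : Path d × Lattice d × ℝ | 1 < p.2.2} :=
    measurableSet_lt (by fun_prop) (by fun_prop)
  exact h3.inter h2

/-- The unnormalised law of a field with a given tail process. -/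
noncomputable def periodicLaw (π : Measure (Path d)) (α : ℝ) (N : ℝ → ℕ) : Measure (Path d) :=
  ((clusterMeasure π α).restrict (baseSet d N)).map (periodic N)

lemma lintegral_periodicLaw {π : Measure (Path d)} [SFinite π] {α : ℝ} {N : ℝ → ℕ}
    (hN : Measurable N) {f : Path d → ℝ≥0∞} (hf : Measurable f) :
    ∫⁻ y, f y ∂(periodicLaw π α N) =
      ∫⁻ x, ∫⁻ s in Set.Ioi 1, ∑ k ∈ cube d (N s), f (periodic N (x, k, s)) ∂(radial α) ∂π := by
  have hm : Measurable fun p => f (periodic (d := d) N p) := hf.comp (measurable_periodic hN)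
  rw [periodicLaw, lintegral_map hf (measurable_periodic hN),
    ← lintegral_indicator (measurableSet_baseSet hN),
    lintegral_clusterMeasure' (hm.indicator (measurableSet_baseSet hN))]
  refine lintegral_congr fun x => ?_
  rw [← lintegral_indicator measurableSet_Ioi]
  refine lintegral_congr fun s => ?_
  have h : ∀ k, (baseSet d N).indicator (fun p => f (periodic N p)) (x, k, s) =
      if 1 < s ∧ k ∈ cube d (N s) then f (periodic N (x, k, s)) else 0 := by
    classical
    intro k
    rw [Set.indicator_apply]
    exact if_congr Iff.rfl rfl rfl
  simp only [h, Set.indicator_apply, Set.mem_Ioi]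
  by_cases hs : 1 < s
  · simp only [hs, true_and, if_true]
    rw [tsum_eq_sum (s := cube d (N s)) fun k hk => if_neg hk]
    exact Finset.sum_congr rfl fun k hk => if_pos hk
  · simp [hs]

/-- At a fixed path and radius, a shift by j only permutes the base points of the period. -/
lemma isStationary_periodicLaw {π : Measure (Path d)} [SFinite π] {α : ℝ} {N : ℝ → ℕ}
    (hN : Measurable N) : IsStationary (periodicLaw π α N) := by
  intro j
  ext B hB
  have hm : Measurable fun x : Path d => B.indicator (1 : Path d → ℝ≥0∞) (shift j x) :=
    (measurable_one.indicator hB).comp (measurable_shift j)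
  rw [← lintegral_indicator_one hB, ← lintegral_indicator_one hB,
    lintegral_map (measurable_one.indicator hB) (measurable_shift j), lintegral_periodicLaw hN hm,
    lintegral_periodicLaw hN (measurable_one.indicator hB)]
  refine lintegral_congr fun x => lintegral_congr fun s => ?_
  refine (Finset.sum_congr rfl fun k _ => ?_).trans
    (sum_cube_shift (N s) j fun k => B.indicator 1 (periodic N (x, k, s)))
  congr 1
  funext i
  simp only [shift, periodic, fold_fold_add]
  congr 3
  abel

/-! ### Convergence to the tail process -/

lemma map_rescale_clusterMeasure {π : Measure (Path d)} [SFinite π] {α u : ℝ} (hu : 0 < u) :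
    (clusterMeasure π α).map (fun p => (p.1, p.2.1, u * p.2.2)) =
      ENNReal.ofReal (u ^ α) • clusterMeasure π α := by
  refine Measure.ext fun B hB => ?_
  have hm : Measurable fun p : Path d × Lattice d × ℝ => (p.1, p.2.1, u * p.2.2) := by fun_prop
  have h1 : Measurable (B.indicator (1 : Path d × Lattice d × ℝ → ℝ≥0∞)) :=
    measurable_one.indicator hB
  have h2 : Measurable fun p : Path d × Lattice d × ℝ =>
      B.indicator (1 : Path d × Lattice d × ℝ → ℝ≥0∞) (p.1, p.2.1, u * p.2.2) := h1.comp hm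
  rw [← lintegral_indicator_one hB, lintegral_map h1 hm, lintegral_clusterMeasure h2,
    Measure.smul_apply, ← lintegral_indicator_one hB, lintegral_clusterMeasure h1, smul_eq_mul,
    ← lintegral_const_mul']
  · refine lintegral_congr fun x => ?_
    rw [← ENNReal.tsum_mul_left]
    refine tsum_congr fun k => ?_
    exact lintegral_radial_comp_mul hu
      (g := fun s => B.indicator (1 : Path d × Lattice d × ℝ → ℝ≥0∞) (x, k, s))
      (h1.comp (by fun_prop))
  · exact ENNReal.ofReal_ne_top

/-- The factor u^α is absorbed by replacing s with u s, after which the measure no longer depends on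
u. For fixed (x, k, s) with s > 0, the point k plus the box lies in the cube of size N(us) once u is
large, so folding is the identity there and the integrand is eventually equal to its limit.
Domination is by ‖f‖ on the clusters exceeding at the origin, a set of mass c. -/
lemma tendsto_periodicLaw {π : Measure (Path d)} [SFinite π] {α : ℝ} (hα : 0 < α)
    (hc0 : coeffMass π id α ≠ 0) (hc1 : coeffMass π id α ≠ ∞)
    {μΘ : Measure (Path d)} [IsProbabilityMeasure μΘ] (hΘ : IsSpectralLaw π α μΘ)
    {N : ℝ → ℕ} (hN : Measurable N) (hNt : Tendsto N atTop atTop)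
    (m : ℕ) (f : (box d m → ℝ) →ᵇ ℝ) :
    Tendsto (fun u : ℝ => u ^ α * ∫ x in {x | u < |x 0|}, f (fun i => u⁻¹ * x i)
        ∂(periodicLaw π α N)) atTop
      (𝓝 ((coeffMass π id α).toReal * ∫ y, f (fun i => y i) ∂(paretoMixture α μΘ))) := by
  have := isProbabilityMeasure_paretoMixture hα (μΘ := μΘ)
  have hE := measurableSet_exceedsAtZero (d := d)
  set ν := clusterMeasure π α with hν
  set F : Path d → ℝ := fun x => f (fun i => x i) with hF
  have hFm : Measurable F := f.continuous.measurable.comp (by fun_prop)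
  have hres := restrict_map_cluster hα hc0 hc1 hΘ
  have hlim : ∫ p, (exceedsAtZero d).indicator F (cluster p) ∂ν =
      (coeffMass π id α).toReal * ∫ y, F y ∂(paretoMixture α μΘ) := by
    rw [← integral_map (φ := cluster) measurable_cluster.aemeasurable
      (hFm.indicator hE).aestronglyMeasurable, integral_indicator hE, hres, integral_smul_measure,
      smul_eq_mul]
  have hpre : ∀ u : ℝ, 0 < u → u ^ α * ∫ x in {x | u < |x 0|}, f (fun i => u⁻¹ * x i)
        ∂(periodicLaw π α N) =
      ∫ p, (baseSet d N).indicator (fun q => (exceedsAtZero d).indicator F (u⁻¹ • periodic N q))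
        (p.1, p.2.1, u * p.2.2) ∂ν := by
    intro u hu
    have hS : MeasurableSet {x : Path d | u < |x 0|} :=
      measurableSet_lt (by fun_prop) (by fun_prop)
    have h1 : ∀ x : Path d, {x : Path d | u < |x 0|}.indicator
        (fun x => f (fun i => u⁻¹ * x i)) x = (exceedsAtZero d).indicator F (u⁻¹ • x) := by
      intro x
      have h2 : x ∈ {x : Path d | u < |x 0|} ↔ u⁻¹ • x ∈ exceedsAtZero d := by
        simp only [exceedsAtZero, Set.mem_ofPred_eq, Pi.smul_apply, smul_eq_mul, abs_mul, abs_inv,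
          abs_of_pos hu]
        rw [← div_eq_inv_mul, one_lt_div hu]
      by_cases h : x ∈ {x : Path d | u < |x 0|}
      · rw [Set.indicator_of_mem h, Set.indicator_of_mem (h2.1 h)]; rfl
      · rw [Set.indicator_of_notMem h, Set.indicator_of_notMem (mt h2.2 h)]
    have hm1 : Measurable fun x : Path d => (exceedsAtZero d).indicator F (u⁻¹ • x) :=
      (hFm.indicator hE).comp (measurable_const_smul _)
    have hm2 : Measurable fun q => (exceedsAtZero d).indicator F (u⁻¹ • periodic N q) :=
      hm1.comp (measurable_periodic hN)
    rw [← integral_indicator hS]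
    simp only [h1]
    rw [periodicLaw, integral_map (measurable_periodic hN).aemeasurable hm1.aestronglyMeasurable,
      ← integral_indicator (measurableSet_baseSet hN)]
    rw [← integral_map (φ := fun p : Path d × Lattice d × ℝ => (p.1, p.2.1, u * p.2.2))
      (by fun_prop) (hm2.indicator (measurableSet_baseSet hN)).aestronglyMeasurable,
      map_rescale_clusterMeasure hu, integral_smul_measure, ENNReal.toReal_ofReal (by positivity),
      smul_eq_mul]
  rw [← hlim]
  refine Tendsto.congr' (f₁ := fun u : ℝ => ∫ p, (baseSet d N).indicator
    (fun q => (exceedsAtZero d).indicator F (u⁻¹ • periodic N q)) (p.1, p.2.1, u * p.2.2) ∂ν)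
    ((eventually_gt_atTop 0).mono fun u hu => (hpre u hu).symm) ?_
  have hS : MeasurableSet (cluster ⁻¹' exceedsAtZero d) := measurable_cluster hE
  refine tendsto_integral_filter_of_dominated_convergence
    ((cluster ⁻¹' exceedsAtZero d).indicator fun _ => ‖f‖) ?_ ?_ ?_ ?_
  · refine Eventually.of_forall fun u => Measurable.aestronglyMeasurable ?_
    have hm1 : Measurable fun x : Path d => (exceedsAtZero d).indicator F (u⁻¹ • x) :=
      (hFm.indicator hE).comp (measurable_const_smul _)
    have hm2 : Measurable fun p : Path d × Lattice d × ℝ => (p.1, p.2.1, u * p.2.2) := by fun_prop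
    exact ((hm1.comp (measurable_periodic hN)).indicator (measurableSet_baseSet hN)).comp hm2
  · filter_upwards [eventually_gt_atTop 0] with u hu
    refine ae_of_all _ fun ⟨x, k, s⟩ => ?_
    by_cases hb : (x, k, u * s) ∈ baseSet d N
    -- The base point lies in the period cube, so folding fixes it: the value at the origin is
    -- already that of the cluster for every u, which makes the bound uniform.
    · have h0 : (u⁻¹ • periodic N (x, k, u * s)) 0 = cluster (x, k, s) 0 := by
        have : fold (N (u * s)) k = k := fold_of_mem hb.2
        simp only [periodic, cluster, shift, Pi.smul_apply, smul_eq_mul, zero_add, this]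
        field_simp
      simp only [Set.indicator_of_mem hb]
      by_cases h : (x, k, s) ∈ cluster ⁻¹' exceedsAtZero d
      · rw [Set.indicator_of_mem h, Set.indicator_of_mem]
        · exact f.norm_coe_le_norm _
        · simpa only [exceedsAtZero, Set.mem_ofPred_eq, Set.mem_preimage, h0] using h
      · rw [Set.indicator_of_notMem h, Set.indicator_of_notMem, norm_zero]
        simpa only [exceedsAtZero, Set.mem_ofPred_eq, Set.mem_preimage, h0] using h
    · simp only [Set.indicator_of_notMem hb, norm_zero]
      exact Set.indicator_nonneg (fun _ _ => norm_nonneg f) _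
  · refine IntegrableOn.integrable_indicator (integrableOn_const ?_) hS
    rw [← Measure.map_apply measurable_cluster hE, ← Measure.restrict_apply_self, hres]
    exact ENNReal.mul_ne_top hc1 (measure_ne_top _ _)
  · have hpos : ∀ᵐ p ∂ν, 0 < p.2.2 := by
      have h0 : MeasurableSet {p : Path d × Lattice d × ℝ | 0 < p.2.2} :=
        measurableSet_lt (by fun_prop) (by fun_prop)
      have h1 : MeasurableSet {p : Path d × Lattice d × ℝ | ¬ 0 < p.2.2} := h0.compl
      rw [ae_iff, ← lintegral_indicator_one h1,
        lintegral_clusterMeasure (measurable_one.indicator h1)]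
      have h2 : ∀ (x : Path d) (k : Lattice d), ∫⁻ s, {p : Path d × Lattice d × ℝ |
          ¬ 0 < p.2.2}.indicator (1 : Path d × Lattice d × ℝ → ℝ≥0∞) (x, k, s) ∂(radial α) = 0 := by
        intro x k
        refine (lintegral_congr_ae ?_).trans lintegral_zero
        filter_upwards [ae_radial_pos α] with s hs
        exact Set.indicator_of_notMem (fun h : ¬ 0 < s => h hs) _
      simp only [h2, tsum_zero, lintegral_zero]
    filter_upwards [hpos] with ⟨x, k, s⟩ hs
    refine tendsto_const_nhds.congr' ?_
    have hus : Tendsto (fun u : ℝ => u * s) atTop atTop := tendsto_id.atTop_mul_const hs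
    -- K bounds the coordinates of k, so N(us) ≥ K + m keeps every i + k with i in the box inside
    -- the cube.
    obtain ⟨K, hK⟩ : ∃ K : ℕ, ∀ j, |k j| ≤ K := by
      refine ⟨∑ j, (k j).natAbs, fun j => ?_⟩
      rw [← Int.natCast_natAbs]
      exact_mod_cast Finset.single_le_sum (f := fun j => (k j).natAbs) (fun _ _ => Nat.zero_le _)
        (Finset.mem_univ j)
    filter_upwards [hus.eventually_gt_atTop 1, (hNt.comp hus).eventually_ge_atTop (K + m),
      eventually_gt_atTop 0] with u h1 h2 h3
    simp only [Function.comp_apply] at h2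
    have hfold : ∀ i : Lattice d, i ∈ box d m → fold (N (u * s)) (i + k) = i + k := by
      refine fun i hi => fold_of_mem (mem_cube.2 fun j => ?_)
      have := abs_le.1 (hi j)
      have := abs_le.1 (hK j)
      simp only [Pi.add_apply]
      omega
    have h0 : (0 : Lattice d) ∈ box d m := fun j => by simp
    have hb : (x, k, u * s) ∈ baseSet d N := ⟨h1, mem_cube.2 fun j => by
      have := abs_le.1 (hK j)
      dsimp only
      omega⟩
    have heq : ∀ i ∈ box d m, (u⁻¹ • periodic N (x, k, u * s)) i = cluster (x, k, s) i := by
      intro i hi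
      simp only [periodic, cluster, shift, Pi.smul_apply, smul_eq_mul, hfold i hi]
      field_simp
    simp only [Set.indicator_of_mem hb]
    have hFe : F (u⁻¹ • periodic N (x, k, u * s)) = F (cluster (x, k, s)) := by
      simp only [hF]
      congr 1
      funext i
      exact heq i i.2
    by_cases h : cluster (x, k, s) ∈ exceedsAtZero d
    · rw [Set.indicator_of_mem h, Set.indicator_of_mem, hFe]
      simpa only [exceedsAtZero, Set.mem_ofPred_eq, heq 0 h0] using h
    · rw [Set.indicator_of_notMem h, Set.indicator_of_notMem]
      simpa only [exceedsAtZero, Set.mem_ofPred_eq, heq 0 h0] using h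

/-- With half-width of order s^(α/(2d)), a period has O(s^(α/2)) points, which is integrable at
infinity against s^(-α-1). Any smaller positive exponent would serve equally well. -/
lemma lintegral_cube_card_lt_top {α : ℝ} (hα : 0 < α) (hd : 1 ≤ d) :
    ∫⁻ s in Set.Ioi 1, ((cube d ⌊s ^ (α / (2 * d))⌋₊).card : ℝ≥0∞) ∂(radial α) < ∞ := by
  have hd0 : (d : ℝ) ≠ 0 := by positivity
  have h1 : ∀ s ∈ Set.Ioi (1 : ℝ), ((cube d ⌊s ^ (α / (2 * d))⌋₊).card : ℝ≥0∞) ≤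
      ENNReal.ofReal (3 ^ d * s ^ (α / 2)) := by
    intro s hs
    have hs0 : (0 : ℝ) < s := zero_lt_one.trans hs
    have h2 : (1 : ℝ) ≤ s ^ (α / (2 * d)) := Real.one_le_rpow (le_of_lt hs) (by positivity)
    have h3 : (⌊s ^ (α / (2 * d))⌋₊ : ℝ) ≤ s ^ (α / (2 * d)) := Nat.floor_le (by positivity)
    have h4 : ((2 * ⌊s ^ (α / (2 * d))⌋₊ + 1 : ℕ) : ℝ) ^ d ≤ (3 * s ^ (α / (2 * d))) ^ d := by
      refine pow_le_pow_left₀ (by positivity) ?_ _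
      push_cast
      linarith
    rw [mul_pow, ← Real.rpow_natCast (s ^ _), ← Real.rpow_mul hs0.le,
      show α / (2 * d) * (d : ℝ) = α / 2 by field_simp] at h4
    rw [card_cube, ← ENNReal.ofReal_natCast]
    exact ENNReal.ofReal_le_ofReal (by exact_mod_cast h4)
  calc _ ≤ ∫⁻ s in Set.Ioi 1, ENNReal.ofReal (3 ^ d * s ^ (α / 2)) ∂(radial α) :=
        setLIntegral_mono (by fun_prop) h1
    _ = ∫⁻ s in Set.Ioi 1, radialDensity α s * ENNReal.ofReal (3 ^ d * s ^ (α / 2)) :=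
        setLIntegral_withDensity_eq_setLIntegral_mul _ (measurable_radialDensity α) (by fun_prop)
          measurableSet_Ioi
    _ = ∫⁻ s in Set.Ioi 1, ENNReal.ofReal (2 * 3 ^ d) *
          ENNReal.ofReal (α / 2 * s ^ (-(α / 2 + 1))) := by
        refine setLIntegral_congr_fun measurableSet_Ioi fun s hs => ?_
        have hs0 : (0 : ℝ) < s := zero_lt_one.trans hs
        simp only [radialDensity]
        rw [Set.indicator_of_mem (s := Set.Ioi (0 : ℝ)) hs0, ← ENNReal.ofReal_mul (by positivity),
          ← ENNReal.ofReal_mul (by positivity), show -(α / 2 + 1) = -(α + 1) + α / 2 by ring,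
          Real.rpow_add hs0]
        ring_nf
    _ < ∞ := by
        rw [lintegral_const_mul _ (by fun_prop), setLIntegral_rpow_Ioi (by positivity) one_pos]
        exact ENNReal.mul_lt_top ENNReal.ofReal_lt_top ENNReal.ofReal_lt_top

/-! ### The Pareto mixture as a tail process -/

lemma integral_cond_eq {Ω : Type*} [MeasurableSpace Ω] (μ : Measure Ω) (S : Set Ω) (f : Ω → ℝ) :
    ∫ x, f x ∂(ProbabilityTheory.cond μ S) = (μ S).toReal⁻¹ * ∫ x in S, f x ∂μ := by
  rw [ProbabilityTheory.cond, integral_smul_measure, ENNReal.toReal_inv, smul_eq_mul]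

lemma ae_paretoMeasure_one_lt (α : ℝ) : ∀ᵐ ρ ∂(paretoMeasure 1 α), 1 < ρ := by
  rw [paretoMeasure_eq]
  exact ae_restrict_mem measurableSet_Ioi

lemma ae_prod_pareto {α : ℝ} (hα : 0 < α) {μΘ : Measure (Path d)} [IsProbabilityMeasure μΘ]
    (h : ∀ᵐ x ∂μΘ, |x 0| = 1) :
    ∀ᵐ p ∂((paretoMeasure 1 α).prod μΘ), 1 < p.1 ∧ |p.2 0| = 1 := by
  have := isProbabilityMeasure_paretoMeasure one_pos hα
  have h1 := Measure.quasiMeasurePreserving_fst (μ := paretoMeasure 1 α) (ν := μΘ)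
  have h2 := Measure.quasiMeasurePreserving_snd (μ := paretoMeasure 1 α) (ν := μΘ)
  exact (h1.ae (ae_paretoMeasure_one_lt α)).and (h2.ae h)

@[fun_prop]
lemma measurable_spectral : Measurable (spectral : Path d → Path d) := by
  unfold spectral; fun_prop

lemma map_spectral_paretoMixture {α : ℝ} (hα : 0 < α) {μΘ : Measure (Path d)}
    [IsProbabilityMeasure μΘ] (h : ∀ᵐ x ∂μΘ, |x 0| = 1) :
    (paretoMixture α μΘ).map spectral = μΘ := by
  have := isProbabilityMeasure_paretoMeasure one_pos hα
  rw [paretoMixture, Measure.map_map measurable_spectral measurable_smul_prod]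
  have h1 : (spectral ∘ fun p : ℝ × Path d => p.1 • p.2) =ᵐ[(paretoMeasure 1 α).prod μΘ]
      Prod.snd := by
    filter_upwards [ae_prod_pareto hα h] with p hp
    have h0 : 0 < p.1 := zero_lt_one.trans hp.1
    funext i
    simp only [Function.comp_apply, spectral, Pi.smul_apply, smul_eq_mul, abs_mul, hp.2,
      abs_of_pos h0]
    field_simp
  rw [Measure.map_congr h1, Measure.map_snd_prod]
  simp

lemma map_abs_paretoMixture {α : ℝ} (hα : 0 < α) {μΘ : Measure (Path d)}
    [IsProbabilityMeasure μΘ] (h : ∀ᵐ x ∂μΘ, |x 0| = 1) :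
    (paretoMixture α μΘ).map (fun y => |y 0|) = paretoMeasure 1 α := by
  have := isProbabilityMeasure_paretoMeasure one_pos hα
  rw [paretoMixture, Measure.map_map (by fun_prop) measurable_smul_prod]
  have h1 : ((fun y : Path d => |y 0|) ∘ fun p : ℝ × Path d => p.1 • p.2)
      =ᵐ[(paretoMeasure 1 α).prod μΘ] Prod.fst := by
    filter_upwards [ae_prod_pareto hα h] with p hp
    simp [abs_mul, hp.2, abs_of_pos (zero_lt_one.trans hp.1)]
  rw [Measure.map_congr h1, Measure.map_fst_prod]
  simp

/-- The Pareto mixture of a moving-average spectral law is a tail process. -/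
lemma isTailProcess_paretoMixture (hd : 1 ≤ d) {π : Measure (Path d)} [IsProbabilityMeasure π]
    {α : ℝ} (hα : 0 < α) (hc0 : coeffMass π id α ≠ 0) (hc1 : coeffMass π id α ≠ ∞)
    {μΘ : Measure (Path d)} [IsProbabilityMeasure μΘ] (hΘ : IsSpectralLaw π α μΘ) :
    IsTailProcess α (paretoMixture α μΘ) := by
  have hPM := isProbabilityMeasure_paretoMixture hα (μΘ := μΘ)
  have h1 := hΘ.ae_abs_eq_one hα
  set N : ℝ → ℕ := fun s => ⌊s ^ (α / (2 * d))⌋₊ with hNdef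
  have hN : Measurable N := Nat.measurable_floor.comp (by fun_prop)
  have hNt : Tendsto N atTop atTop :=
    tendsto_nat_floor_atTop.comp (tendsto_rpow_atTop (by positivity))
  set μ := periodicLaw π α N with hμ
  have hlim := tendsto_periodicLaw hα hc0 hc1 hΘ hN hNt
  have hfin : μ Set.univ < ∞ := by
    rw [← lintegral_one, hμ, lintegral_periodicLaw hN measurable_const]
    simp only [Finset.sum_const, nsmul_eq_mul, mul_one, lintegral_const, measure_univ]
    exact lintegral_cube_card_lt_top hα hd
  have : IsFiniteMeasure μ := ⟨hfin⟩
  -- The constant test function 1 gives the tail asymptotics of the value at the origin.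
  have hp : Tendsto (fun u : ℝ => u ^ α * (μ {x | u < |x 0|}).toReal) atTop
      (𝓝 (coeffMass π id α).toReal) := by
    have := hlim 0 (BoundedContinuousFunction.const _ 1)
    simpa [Measure.real] using this
  have hcpos : 0 < (coeffMass π id α).toReal := ENNReal.toReal_pos hc0 hc1
  have hpos : ∀ᶠ u in atTop, 0 < u ^ α * (μ {x | u < |x 0|}).toReal :=
    hp.eventually (lt_mem_nhds hcpos)
  -- Positivity holds at large levels by the limit, and at lower levels by monotonicity.
  have hpos' : ∀ u : ℝ, 0 < μ {x | u < |x 0|} := by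
    intro u
    obtain ⟨v, hv, huv⟩ := (hpos.and (eventually_ge_atTop u)).exists
    have h2 : μ {x | v < |x 0|} ≠ 0 := fun h => by simp [h] at hv
    exact (pos_iff_ne_zero.2 h2).trans_le (measure_mono fun x hx => lt_of_le_of_lt huv hx)
  have hZ0 : μ Set.univ ≠ 0 := ((hpos' 0).trans_le (measure_mono (Set.subset_univ _))).ne'
  have hZ : (μ Set.univ).toReal ≠ 0 := (ENNReal.toReal_pos hZ0 hfin.ne).ne'
  have hstat : IsStationary μ := isStationary_periodicLaw hN
  refine ⟨(μ Set.univ)⁻¹ • μ, ⟨?_⟩, ?_, ⟨?_, ?_, ?_⟩, map_abs_paretoMixture hα h1⟩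
  · rw [Measure.smul_apply, smul_eq_mul, ENNReal.inv_mul_cancel hZ0 hfin.ne]
  · intro k
    rw [Measure.map_smul, hstat k]
  · intro u
    rw [Measure.smul_apply, smul_eq_mul]
    exact ENNReal.mul_pos (ENNReal.inv_ne_zero.2 hfin.ne) (hpos' u).ne'
  · have h2 : ∀ᵐ r ∂((paretoMixture α μΘ).map fun y => |y 0|), 1 < r := by
      rw [map_abs_paretoMixture hα h1]
      exact ae_paretoMeasure_one_lt α
    have h3 : Measurable fun y : Path d => |y 0| := by fun_prop
    exact ae_of_ae_map h3.aemeasurable h2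
  · intro m f
    -- The conditional expectation is a quotient of two quantities of order u^(-α); the total mass
    -- of μ cancels in it.
    have h2 := (hlim m f).div hp hcpos.ne'
    rw [mul_div_assoc, mul_comm, div_mul_cancel₀ _ hcpos.ne'] at h2
    refine h2.congr' ?_
    filter_upwards [eventually_gt_atTop 0] with u hu
    rw [integral_cond_eq, Measure.restrict_smul, integral_smul_measure, Measure.smul_apply,
      smul_eq_mul, smul_eq_mul, ENNReal.toReal_mul, ENNReal.toReal_inv]
    have h3 : (μ {x | u < |x 0|}).toReal ≠ 0 :=
      (ENNReal.toReal_pos (hpos' u).ne' (measure_ne_top _ _)).ne'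
    have h4 : u ^ α ≠ 0 := by positivity
    simp only [Pi.div_apply]
    rw [← hμ]
    field_simp

lemma isSpectralTailProcess_of_isSpectralLaw (hd : 1 ≤ d) {π : Measure (Path d)}
    [IsProbabilityMeasure π] {α : ℝ} (hα : 0 < α) (hc0 : coeffMass π id α ≠ 0)
    (hc1 : coeffMass π id α ≠ ∞) {μΘ : Measure (Path d)} [IsProbabilityMeasure μΘ]
    (hΘ : IsSpectralLaw π α μΘ) : IsSpectralTailProcess α μΘ :=
  ⟨paretoMixture α μΘ, isProbabilityMeasure_paretoMixture hα,
    isTailProcess_paretoMixture hd hα hc0 hc1 hΘ,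
    (map_spectral_paretoMixture hα (hΘ.ae_abs_eq_one hα)).symm⟩

/-! ### Independence of the modulus and the spectral tail process -/

lemma zero_mem_box (d m : ℕ) : (0 : Lattice d) ∈ box d m := fun j => by simp

/-- A continuous ramp, vanishing for `|v| ≤ t` and equal to one for large `|v|`. -/
noncomputable def ramp (t : ℝ) (n : ℕ) (v : ℝ) : ℝ := min 1 (n * max 0 (|v| - t))

lemma continuous_ramp (t : ℝ) (n : ℕ) : Continuous (ramp t n) := by unfold ramp; fun_prop

lemma ramp_nonneg (t : ℝ) (n : ℕ) (v : ℝ) : 0 ≤ ramp t n v := by unfold ramp; positivity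

lemma ramp_le_one (t : ℝ) (n : ℕ) (v : ℝ) : ramp t n v ≤ 1 := min_le_left _ _

lemma norm_ramp_le_one (t : ℝ) (n : ℕ) (v : ℝ) : ‖ramp t n v‖ ≤ 1 := by
  rw [Real.norm_of_nonneg (ramp_nonneg t n v)]; exact ramp_le_one t n v

lemma ramp_eq_zero {t v : ℝ} (h : |v| ≤ t) (n : ℕ) : ramp t n v = 0 := by
  rw [ramp, max_eq_left (by linarith)]; simp

lemma tendsto_ramp (t v : ℝ) :
    Tendsto (fun n => ramp t n v) atTop (𝓝 ({v : ℝ | t < |v|}.indicator 1 v)) := by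
  by_cases h : t < |v|
  · rw [Set.indicator_of_mem (s := {v : ℝ | t < |v|}) h]
    have h1 : 0 < max 0 (|v| - t) := lt_max_of_lt_right (by linarith)
    have h2 : Tendsto (fun n : ℕ => (n : ℝ) * max 0 (|v| - t)) atTop atTop :=
      tendsto_natCast_atTop_atTop.atTop_mul_const h1
    refine tendsto_const_nhds.congr' ?_
    filter_upwards [h2.eventually_ge_atTop 1] with n hn
    exact (min_eq_left hn).symm
  · rw [Set.indicator_of_notMem (s := {v : ℝ | t < |v|}) h]
    simp [ramp_eq_zero (not_lt.1 h)]

/-- A field on a box extended by zero. -/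
noncomputable def extendBox (m : ℕ) (z : box d m → ℝ) : Path d := by
  classical exact fun i => if h : i ∈ box d m then z ⟨i, h⟩ else 0

lemma continuous_extendBox (m : ℕ) : Continuous (extendBox m : (box d m → ℝ) → Path d) := by
  refine continuous_pi fun i => ?_
  by_cases h : i ∈ box d m
  · simpa [extendBox, h] using continuous_apply _
  · simpa [extendBox, h] using continuous_const

lemma tendsto_extendBox (y : Path d) :
    Tendsto (fun m => extendBox m fun i : box d m => y i) atTop (𝓝 y) := by
  refine tendsto_pi_nhds.2 fun i => tendsto_const_nhds.congr' ?_
  filter_upwards [eventually_ge_atTop (∑ j, (i j).natAbs)] with m hm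
  have h : i ∈ box d m := fun j => by
    rw [← Int.natCast_natAbs]
    exact_mod_cast (Finset.single_le_sum (f := fun j => (i j).natAbs) (fun _ _ => Nat.zero_le _)
      (Finset.mem_univ j)).trans hm
  simp [extendBox, h]

/-- Test functions vanishing where the origin does not exceed `t` scale by a common factor. -/
lemma IsTailProcessOf.exists_scaling {μX μY : Measure (Path d)} [IsProbabilityMeasure μX]
    [IsProbabilityMeasure μY] (h : IsTailProcessOf μX μY) {t : ℝ} (ht : 1 ≤ t) :
    ∃ R : ℝ, ∀ (m : ℕ) (g : (box d m → ℝ) →ᵇ ℝ),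
      (∀ z, |z ⟨0, zero_mem_box d m⟩| ≤ t → g z = 0) →
      ∫ y, g (fun i => y i) ∂μY = R * ∫ y, g (fun i => t * y i) ∂μY := by
  have ht0 : 0 < t := zero_lt_one.trans_le ht
  let p : ℝ → ℝ := fun u => (μX {x | u < |x 0|}).toReal
  have hp : ∀ u, p u ≠ 0 := fun u =>
    (ENNReal.toReal_pos (h.tail_pos u).ne' (measure_ne_top _ _)).ne'
  let A : (m : ℕ) → ((box d m → ℝ) →ᵇ ℝ) → ℝ → ℝ := fun m g u =>
    ∫ x, g (fun i => u⁻¹ * x i) ∂(cond μX {x | u < |x 0|})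
  let sc : (m : ℕ) → ((box d m → ℝ) →ᵇ ℝ) → ((box d m → ℝ) →ᵇ ℝ) := fun m g =>
    g.compContinuous ⟨fun z i => t * z i, by fun_prop⟩
  have hA : ∀ m g, Tendsto (A m g) atTop (𝓝 (∫ y, g (fun i => y i) ∂μY)) := h.tendsto
  have hB : ∀ m g, Tendsto (fun u => A m (sc m g) (t * u)) atTop
      (𝓝 (∫ y, g (fun i => t * y i) ∂μY)) := fun m g =>
    (h.tendsto m (sc m g)).comp (tendsto_id.const_mul_atTop ht0)
  -- Since g(x/u) vanishes for |x_0| ≤ tu, conditioning at level u can be exchanged for conditioning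
  -- at level tu, at the price of the ratio of the two tail probabilities.
  have hAB : ∀ m (g : (box d m → ℝ) →ᵇ ℝ), (∀ z, |z ⟨0, zero_mem_box d m⟩| ≤ t → g z = 0) →
      ∀ u : ℝ, 0 < u → A m g u = p (t * u) / p u * A m (sc m g) (t * u) := by
    intro m g hg u hu
    have hm : ∀ v : ℝ, MeasurableSet {x : Path d | v < |x 0|} := fun v =>
      measurableSet_lt (by fun_prop) (by fun_prop)
    have h1 : ∫ x in {x | u < |x 0|}, g (fun i => u⁻¹ * x i) ∂μX =
        ∫ x in {x | t * u < |x 0|}, g (fun i => u⁻¹ * x i) ∂μX := by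
      refine setIntegral_eq_of_subset_of_forall_sdiff_eq_zero (μ := μX)
        (f := fun x : Path d => g (fun i => u⁻¹ * x i)) (s := {x : Path d | t * u < |x 0|})
        (hm u) (fun x hx => ?_) fun x hx => hg _ ?_
      · have hx : t * u < |x 0| := hx
        have : u ≤ t * u := le_mul_of_one_le_left hu.le ht
        exact lt_of_le_of_lt this hx
      · have hx : |x 0| ≤ t * u := not_lt.1 hx.2
        rw [abs_mul, abs_inv, abs_of_pos hu, inv_mul_le_iff₀ hu, mul_comm u]
        exact hx
    have h2 : ∀ x : Path d, sc m g (fun i => (t * u)⁻¹ * x i) = g (fun i => u⁻¹ * x i) := by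
      intro x
      simp only [sc, BoundedContinuousFunction.compContinuous_apply, ContinuousMap.coe_mk]
      congr 1
      funext i
      field_simp
    simp only [A, integral_cond_eq, h2, h1]
    have h3 := hp (t * u)
    have h4 := hp u
    simp only [p] at h3 h4 ⊢
    rw [div_mul_eq_mul_div, mul_inv_cancel_left₀ h3, div_eq_inv_mul]
  -- A reference test function with nonzero limit: it forces the ratio p(tu)/p(u) to converge, and
  -- the limit R then serves every m and g.
  let g0 : (box d 0 → ℝ) →ᵇ ℝ := BoundedContinuousFunction.ofNormedAddCommGroup
    (fun z => ramp t 1 (z ⟨0, zero_mem_box d 0⟩))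
    ((continuous_ramp t 1).comp (continuous_apply _)) 1 (fun z => norm_ramp_le_one _ _ _)
  have hg0 : ∀ z, |z ⟨0, zero_mem_box d 0⟩| ≤ t → g0 z = 0 := fun z hz => ramp_eq_zero hz 1
  have hb0 : ∫ y, g0 (fun i => t * y i) ∂μY ≠ 0 := by
    have hnn : ∀ y : Path d, 0 ≤ g0 (fun i => t * y i) := fun y => ramp_nonneg _ _ _
    have hint : Integrable (fun y : Path d => g0 (fun i => t * y i)) μY :=
      Integrable.of_bound (g0.continuous.measurable.comp (by fun_prop)).aestronglyMeasurable 1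
        (ae_of_all _ fun y => norm_ramp_le_one _ _ _)
    intro h0
    rw [integral_eq_zero_iff_of_nonneg hnn hint] at h0
    have hfalse : ∀ᵐ y ∂μY, False := by
      filter_upwards [h0, h.exceeds] with y hy1 hy2
      have h5 : 0 < |t * y 0| - t := by
        rw [abs_mul, abs_of_pos ht0]
        nlinarith
      have : 0 < ramp t 1 (t * y 0) := by
        rw [ramp, max_eq_right h5.le]
        simpa using h5
      exact this.ne' hy1
    exact IsProbabilityMeasure.ne_zero μY (by simpa using hfalse)
  have hR : Tendsto (fun u => p (t * u) / p u) atTop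
      (𝓝 ((∫ y, g0 (fun i => y i) ∂μY) / ∫ y, g0 (fun i => t * y i) ∂μY)) := by
    refine ((hA 0 g0).div (hB 0 g0) hb0).congr' ?_
    filter_upwards [(hB 0 g0).eventually_ne hb0, eventually_gt_atTop 0] with u h1 h2
    simp only [Pi.div_apply]
    rw [hAB 0 g0 hg0 u h2, mul_div_assoc, div_self h1, mul_one]
  refine ⟨(∫ y, g0 (fun i => y i) ∂μY) / ∫ y, g0 (fun i => t * y i) ∂μY, fun m g hg =>
    tendsto_nhds_unique (hA m g) ?_⟩
  refine (hR.mul (hB m g)).congr' ?_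
  filter_upwards [eventually_gt_atTop 0] with u hu using (hAB m g hg u hu).symm

/-- A function of the whole path restricted to {t < |y_0|} is neither local nor continuous.
Truncation to a box and a ramp at the origin, both indexed by n, supply admissible test functions,
and dominated convergence removes both approximations at once. -/
lemma IsTailProcessOf.exists_setIntegral_eq {μX μY : Measure (Path d)} [IsProbabilityMeasure μX]
    [IsProbabilityMeasure μY] (h : IsTailProcessOf μX μY) {t : ℝ} (ht : 1 ≤ t) :
    ∃ R : ℝ, ∀ F : Path d →ᵇ ℝ,
      ∫ y in {y | t < |y 0|}, F y ∂μY = R * ∫ y, F (t • y) ∂μY := by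
  have ht0 : 0 < t := zero_lt_one.trans_le ht
  obtain ⟨R, hR⟩ := h.exists_scaling ht
  refine ⟨R, fun F => ?_⟩
  have hS : MeasurableSet {y : Path d | t < |y 0|} := measurableSet_lt (by fun_prop) (by fun_prop)
  let g : (n : ℕ) → (box d n → ℝ) →ᵇ ℝ := fun n =>
    BoundedContinuousFunction.ofNormedAddCommGroup
      (fun z => F (extendBox n z) * ramp t n (z ⟨0, zero_mem_box d n⟩))
      ((F.continuous.comp (continuous_extendBox n)).mul
        ((continuous_ramp t n).comp (continuous_apply _))) (‖F‖ * 1) (fun z => by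
          rw [norm_mul]
          exact mul_le_mul (F.norm_coe_le_norm _) (norm_ramp_le_one _ _ _) (norm_nonneg _)
            (norm_nonneg _))
  have hgb : ∀ n z, ‖g n z‖ ≤ ‖F‖ * 1 := fun n z => by
    change ‖F (extendBox n z) * ramp t n (z ⟨0, zero_mem_box d n⟩)‖ ≤ _
    rw [norm_mul]
    exact mul_le_mul (F.norm_coe_le_norm _) (norm_ramp_le_one _ _ _) (norm_nonneg _)
      (norm_nonneg _)
  have hgm : ∀ n, Measurable (g n) := fun n => (g n).continuous.measurable
  have hg0 : ∀ n z, |z ⟨0, zero_mem_box d n⟩| ≤ t → g n z = 0 := fun n z hz => by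
    change F (extendBox n z) * ramp t n (z ⟨0, zero_mem_box d n⟩) = 0
    rw [ramp_eq_zero hz, mul_zero]
  have hconv : ∀ y : Path d, Tendsto (fun n => g n fun i => y i) atTop
      (𝓝 (F y * {v : ℝ | t < |v|}.indicator 1 (y 0))) := fun y =>
    ((F.continuous.tendsto y).comp (tendsto_extendBox y)).mul (tendsto_ramp t (y 0))
  have h1 : Tendsto (fun n => ∫ y, g n (fun i => y i) ∂μY) atTop
      (𝓝 (∫ y in {y | t < |y 0|}, F y ∂μY)) := by
    rw [← integral_indicator hS]
    refine tendsto_integral_of_dominated_convergence (fun _ => ‖F‖ * 1)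
      (fun n => ((hgm n).comp (by fun_prop)).aestronglyMeasurable) (integrable_const _)
      (fun n => ae_of_all _ fun y => hgb n _) (ae_of_all _ fun y => ?_)
    convert hconv y using 2
    by_cases hy : t < |y 0|
    · rw [Set.indicator_of_mem (s := {y : Path d | t < |y 0|}) hy,
        Set.indicator_of_mem (s := {v : ℝ | t < |v|}) hy, Pi.one_apply, mul_one]
    · rw [Set.indicator_of_notMem (s := {y : Path d | t < |y 0|}) hy,
        Set.indicator_of_notMem (s := {v : ℝ | t < |v|}) hy, mul_zero]
  have h2 : Tendsto (fun n => ∫ y, g n (fun i => t * y i) ∂μY) atTop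
      (𝓝 (∫ y, F (t • y) ∂μY)) := by
    refine tendsto_integral_of_dominated_convergence (fun _ => ‖F‖ * 1)
      (fun n => ((hgm n).comp (by fun_prop)).aestronglyMeasurable) (integrable_const _)
      (fun n => ae_of_all _ fun y => hgb n _) ?_
    filter_upwards [h.exceeds] with y hy
    -- As |Y_0| > 1 almost surely, the indicator is one after scaling and drops out of the limit.
    have hy' : t < |(t • y) 0| := by
      rw [Pi.smul_apply, smul_eq_mul, abs_mul, abs_of_pos ht0]
      nlinarith
    have := hconv (t • y)
    rw [Set.indicator_of_mem (s := {v : ℝ | t < |v|}) hy', Pi.one_apply, mul_one] at this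
    exact this
  refine tendsto_nhds_unique h1 ((h2.const_mul R).congr fun n => ?_)
  exact (hR n (g n) (hg0 n)).symm

/-- Homogeneity of the law of a tail process. -/
lemma IsTailProcess.restrict_eq {α : ℝ} (hα : 0 < α) {μY : Measure (Path d)}
    [IsProbabilityMeasure μY] (h : IsTailProcess α μY) {t : ℝ} (ht : 1 ≤ t) :
    μY.restrict {y | t < |y 0|} = ENNReal.ofReal (t ^ (-α)) • μY.map (fun y => t • y) := by
  obtain ⟨μX, hX, -, hY, hpar⟩ := h
  have ht0 : 0 < t := zero_lt_one.trans_le ht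
  obtain ⟨R, hR⟩ := hY.exists_setIntegral_eq ht
  have hm : Measurable fun y : Path d => t • y := measurable_const_smul t
  have hS : (μY {y | t < |y 0|}) = ENNReal.ofReal (t ^ (-α)) := by
    have hm0 : Measurable fun y : Path d => |y 0| := by fun_prop
    have h1 : μY {y | t < |y 0|} = (μY.map fun y => |y 0|) (Set.Ioi t) :=
      (Measure.map_apply hm0 measurableSet_Ioi).symm
    rw [h1, hpar, paretoMeasure_eq, Measure.restrict_apply measurableSet_Ioi,
      Set.inter_eq_left.2 (Set.Ioi_subset_Ioi ht), radial_Ioi hα ht0]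
  -- Taking F = 1 identifies R with the Pareto tail at t.
  have hRt : R = t ^ (-α) := by
    have := hR (BoundedContinuousFunction.const _ 1)
    simp only [BoundedContinuousFunction.const_apply, integral_const, Measure.real, smul_eq_mul,
      mul_one, Measure.restrict_apply_univ, hS, measure_univ, ENNReal.toReal_one] at this
    rw [← this, ENNReal.toReal_ofReal (by positivity)]
  have hfin : IsFiniteMeasure (ENNReal.ofReal (t ^ (-α)) • μY.map (fun y => t • y)) :=
    Measure.smul_finite _ ENNReal.ofReal_ne_top
  refine ext_of_forall_integral_eq_of_IsFiniteMeasure fun F => ?_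
  rw [hR F, integral_smul_measure, integral_map hm.aemeasurable
    F.continuous.measurable.aestronglyMeasurable, ENNReal.toReal_ofReal (by positivity), hRt,
    smul_eq_mul]

/-- The modulus at the origin is independent of the spectral tail process. -/
lemma IsTailProcess.eq_paretoMixture {α : ℝ} (hα : 0 < α) {μY : Measure (Path d)}
    [IsProbabilityMeasure μY] (h : IsTailProcess α μY) :
    μY = paretoMixture α (μY.map spectral) := by
  have := isProbabilityMeasure_paretoMeasure one_pos hα
  have hex : ∀ᵐ y ∂μY, 1 < |y 0| := by
    obtain ⟨_, _, _, hY, _⟩ := h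
    exact hY.exceeds
  have := Measure.isProbabilityMeasure_map (μ := μY) measurable_spectral.aemeasurable
  have hj : Measurable fun y : Path d => (|y 0|, spectral y) := by fun_prop
  have hprod : (paretoMeasure 1 α).prod (μY.map spectral) =
      μY.map fun y => (|y 0|, spectral y) := by
    refine Measure.prod_eq fun s D hs hD => ?_
    have hT : MeasurableSet (spectral ⁻¹' D) := measurable_spectral hD
    have hm0 : Measurable fun y : Path d => |y 0| := by fun_prop
    -- The event that the spectral process lies in D is invariant under positive scaling, so
    -- homogeneity makes its mass above level t decay exactly like t^(-α), whatever D is.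
    have key : (μY.restrict (spectral ⁻¹' D)).map (fun y => |y 0|) =
        μY (spectral ⁻¹' D) • paretoMeasure 1 α := by
      have hfin : IsFiniteMeasure (μY (spectral ⁻¹' D) • paretoMeasure 1 α) :=
        Measure.smul_finite _ (measure_ne_top _ _)
      have hIoi : ∀ a : ℝ, (μY.restrict (spectral ⁻¹' D)).map (fun y => |y 0|) (Set.Ioi a) =
          (μY (spectral ⁻¹' D) • paretoMeasure 1 α) (Set.Ioi a) := by
        intro a
        -- Homogeneity is available only for t ≥ 1; since |Y_0| > 1 almost surely, a level a below
        -- one may be raised to one.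
        have h1 : μY ((fun y : Path d => |y 0|) ⁻¹' Set.Ioi a ∩ spectral ⁻¹' D) =
            μY (spectral ⁻¹' D ∩ {y | a ⊔ 1 < |y 0|}) := by
          refine measure_congr ?_
          filter_upwards [hex] with y hy
          refine propext ⟨fun h => ⟨h.2, max_lt h.1 hy⟩, fun h => ⟨?_, h.1⟩⟩
          exact (le_max_left a 1).trans_lt h.2
        have h2 : ∀ y : Path d, spectral ((a ⊔ 1) • y) = spectral y := by
          intro y
          have h3 : 0 < a ⊔ 1 := lt_max_of_lt_right one_pos
          funext i
          simp only [spectral, Pi.smul_apply, smul_eq_mul, abs_mul, abs_of_pos h3]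
          field_simp
        rw [Measure.map_apply hm0 measurableSet_Ioi, Measure.restrict_apply
          (hm0 measurableSet_Ioi), h1, ← Measure.restrict_apply hT,
          h.restrict_eq hα (le_max_right a 1), Measure.smul_apply, Measure.smul_apply,
          Measure.map_apply (measurable_const_smul _) hT, paretoMeasure_eq,
          Measure.restrict_apply measurableSet_Ioi, Set.Ioi_inter_Ioi,
          radial_Ioi hα (lt_max_of_lt_right one_pos), smul_eq_mul, smul_eq_mul, mul_comm]
        congr 2
        ext y
        simp only [Set.mem_preimage, h2]
      refine Measure.ext_of_Iic _ _ fun a => ?_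
      rw [← Set.compl_Ioi, measure_compl measurableSet_Ioi (measure_ne_top _ _),
        measure_compl measurableSet_Ioi (measure_ne_top _ _), hIoi a]
      congr 1
      rw [Measure.map_apply hm0 MeasurableSet.univ]
      simp
    rw [Measure.map_apply hj (hs.prod hD), Measure.map_apply measurable_spectral hD, mul_comm,
      ← smul_eq_mul, ← Measure.smul_apply, ← key, Measure.map_apply hm0 hs,
      Measure.restrict_apply (hm0 hs)]
    rfl
  rw [paretoMixture, hprod, Measure.map_map measurable_smul_prod hj]
  have h1 : ((fun p : ℝ × Path d => p.1 • p.2) ∘ fun y : Path d => (|y 0|, spectral y))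
      =ᵐ[μY] id := by
    filter_upwards [hex] with y hy
    have : |y 0| ≠ 0 := (zero_lt_one.trans hy).ne'
    funext i
    simp only [Function.comp_apply, spectral, Pi.smul_apply, smul_eq_mul, id]
    field_simp
  rw [Measure.map_congr h1, Measure.map_id]

/-! ### Fields vanishing at infinity -/

/-- Testing the levels 1/(n+1) suffices; this countable form yields measurability of `l0`. -/
lemma mem_l0_iff {x : Path d} : x ∈ l0 d ↔ ∀ n : ℕ, {i | 1 < |(n + 1) * x i|}.Finite := by
  constructor
  · intro h n
    have h1 := (tendsto_order.1 (show Tendsto (fun i => |x i|) cofinite (𝓝 0) from h)).2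
      (1 / ((n : ℝ) + 1)) (by positivity)
    refine (eventually_cofinite.1 h1).subset fun i hi => not_lt.2 ?_
    have hi : 1 < |((n : ℝ) + 1) * x i| := hi
    rw [abs_mul, abs_of_pos (by positivity)] at hi
    rw [div_le_iff₀ (by positivity), mul_comm]
    exact hi.le
  · intro h
    refine tendsto_order.2 ⟨fun a ha => Eventually.of_forall fun i => ha.trans_le (abs_nonneg _),
      fun a ha => ?_⟩
    obtain ⟨n, hn⟩ := exists_nat_one_div_lt ha
    refine eventually_cofinite.2 ((h n).subset fun i hi => ?_)
    have hi : a ≤ |x i| := not_lt.1 hi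
    have h1 : 0 < (n : ℝ) + 1 := by positivity
    change 1 < |((n : ℝ) + 1) * x i|
    rw [abs_mul, abs_of_pos h1]
    rw [div_lt_iff₀ h1] at hn
    nlinarith

lemma encard_exceedances (x : Path d) :
    ((exceedances x).encard : ℝ≥0∞) =
      ∑' k, {y : Path d | 1 < |y k|}.indicator (1 : Path d → ℝ≥0∞) x := by
  rw [← ENNReal.tsum_set_one, tsum_subtype (exceedances x) fun _ => (1 : ℝ≥0∞)]
  refine tsum_congr fun k => ?_
  by_cases h : 1 < |x k|
  · rw [Set.indicator_of_mem (s := exceedances x) h,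
      Set.indicator_of_mem (s := {y : Path d | 1 < |y k|}) h, Pi.one_apply]
  · rw [Set.indicator_of_notMem (s := exceedances x) h,
      Set.indicator_of_notMem (s := {y : Path d | 1 < |y k|}) h]

lemma measurableSet_exceeds (k : Lattice d) : MeasurableSet {y : Path d | 1 < |y k|} :=
  measurableSet_lt (by fun_prop) (by fun_prop)

lemma measurable_encard_exceedances :
    Measurable fun x : Path d => ((exceedances x).encard : ℝ≥0∞) := by
  simp only [encard_exceedances]
  exact Measurable.tsum fun k => measurable_one.indicator (measurableSet_exceeds k)

lemma measurableSet_finite_exceedances :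
    MeasurableSet {x : Path d | (exceedances x).Finite} := by
  have h : {x : Path d | (exceedances x).Finite} =
      (fun x : Path d => ((exceedances x).encard : ℝ≥0∞)) ⁻¹' {∞}ᶜ := by
    ext x
    simp
  rw [h]
  exact measurable_encard_exceedances (measurableSet_singleton _).compl

lemma measurableSet_E0 : MeasurableSet (E0 d) :=
  (measurableSet_exceeds 0).inter measurableSet_finite_exceedances

lemma measurableSet_l0 : MeasurableSet (l0 d) := by
  have h : l0 d = ⋂ n : ℕ, (fun x : Path d => ((n : ℝ) + 1) • x) ⁻¹'
      {x : Path d | (exceedances x).Finite} := by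
    ext x
    rw [mem_l0_iff, Set.mem_iInter]
    rfl
  rw [h]
  exact MeasurableSet.iInter fun n => (measurable_const_smul _) measurableSet_finite_exceedances

lemma smul_mem_l0 {x : Path d} (hx : x ∈ l0 d) (s : ℝ) : s • x ∈ l0 d := by
  have h : Tendsto (fun i => |s| * |x i|) cofinite (𝓝 (|s| * 0)) := Tendsto.const_mul _ hx
  rw [mul_zero] at h
  exact h.congr fun i => by simp [abs_mul]

lemma finite_exceedances {x : Path d} (hx : x ∈ l0 d) : (exceedances x).Finite := by
  have := mem_l0_iff.1 hx 0
  simpa [exceedances] using this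

lemma bddAbove_abs {x : Path d} (hx : x ∈ l0 d) : BddAbove (Set.range fun i => |x i|) := by
  have h1 := (finite_exceedances hx).image fun i => |x i|
  obtain ⟨b, hb⟩ := h1.bddAbove
  refine ⟨max b 1, ?_⟩
  rintro _ ⟨i, rfl⟩
  by_cases h : 1 < |x i|
  · exact (hb ⟨i, h, rfl⟩).trans (le_max_left _ _)
  · exact (not_lt.1 h).trans (le_max_right _ _)

lemma one_lt_supNorm_iff {x : Path d} (hx : x ∈ l0 d) :
    1 < supNorm x ↔ (exceedances x).Nonempty := by
  rw [supNorm, lt_ciSup_iff (bddAbove_abs hx)]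
  rfl

lemma supNorm_smul {s : ℝ} (hs : 0 ≤ s) (x : Path d) : supNorm (s • x) = s * supNorm x := by
  simp only [supNorm, Pi.smul_apply, smul_eq_mul, abs_mul, abs_of_nonneg hs]
  exact (Real.mul_iSup_of_nonneg hs _).symm

lemma supNorm_shift (k : Lattice d) (x : Path d) : supNorm (shift k x) = supNorm x :=
  (Equiv.addRight k).iSup_comp (g := fun i => |x i|)

lemma supNorm_nonneg (x : Path d) : 0 ≤ supNorm x := Real.iSup_nonneg fun _ => abs_nonneg _

@[fun_prop]
lemma measurable_supNorm : Measurable (supNorm : Path d → ℝ) :=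
  Measurable.iSup fun i => by fun_prop

lemma shift_shift (j k : Lattice d) (x : Path d) : shift j (shift k x) = shift (j + k) x := by
  funext i
  simp [shift, add_assoc]

lemma mem_exceedances_shift {j k : Lattice d} {x : Path d} :
    j ∈ exceedances (shift k x) ↔ j + k ∈ exceedances x := Iff.rfl

lemma encard_exceedances_shift (k : Lattice d) (x : Path d) :
    (exceedances (shift k x)).encard = (exceedances x).encard := by
  have h : exceedances x = (fun j => j + k) '' exceedances (shift k x) := by
    ext j
    simp only [Set.mem_image, mem_exceedances_shift]
    exact ⟨fun h => ⟨j - k, by simpa using h, by simp⟩, fun ⟨i, hi, hj⟩ => hj ▸ hi⟩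
  rw [h, (add_left_injective k).encard_image]

lemma shift_mem_exceedsAtZero {k : Lattice d} {x : Path d} :
    shift k x ∈ exceedsAtZero d ↔ k ∈ exceedances x := by
  simp [exceedsAtZero, exceedances, shift]

/-! ### Integrals of functions with invariant orbit sums -/

/-- `x / ‖x‖`. -/
noncomputable def normalize (x : Path d) : Path d := (supNorm x)⁻¹ • x

@[fun_prop]
lemma measurable_normalize : Measurable (normalize : Path d → Path d) := by
  refine measurable_pi_lambda _ fun i => ?_
  simp only [normalize, Pi.smul_apply, smul_eq_mul]
  fun_prop

lemma normalize_smul {s : ℝ} (hs : 0 < s) (x : Path d) : normalize (s • x) = normalize x := by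
  funext i
  simp only [normalize, supNorm_smul hs.le, Pi.smul_apply, smul_eq_mul]
  field_simp

lemma normalize_shift (k : Lattice d) (x : Path d) :
    normalize (shift k x) = shift k (normalize x) := by
  funext i
  simp [normalize, supNorm_shift, shift]

lemma radial_one_lt_mul {α : ℝ} (hα : 0 < α) {b : ℝ} (hb : 0 ≤ b) :
    radial α {s | 1 < s * b} = ENNReal.ofReal (b ^ α) := by
  rcases hb.eq_or_lt with rfl | hb
  · have h : {s : ℝ | 1 < s * 0} = ∅ := by
      ext s
      simp [zero_le_one.not_gt]
    rw [h]
    simp [Real.zero_rpow hα.ne']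
  · have h : {s : ℝ | 1 < s * b} = Set.Ioi b⁻¹ := by
      ext s
      rw [Set.mem_Ioi, inv_lt_iff_one_lt_mul₀ hb]
      rfl
    rw [h, radial_Ioi hα (by positivity), Real.inv_rpow hb.le, Real.rpow_neg hb.le, inv_inv]

/-- The expectation is c⁻¹ times an integral of F over exceeding clusters. Summing over k first
gives the orbit sum of s x, which depends on s > 0 only through the condition s‖x‖ > 1; these radii
have mass ‖x‖^α. -/
lemma lintegral_paretoMixture_of_orbit_sum {π : Measure (Path d)} [SFinite π]
    (hπ : ∀ᵐ x ∂π, x ∈ l0 d) {α : ℝ} (hα : 0 < α)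
    (hc0 : coeffMass π id α ≠ 0) (hc1 : coeffMass π id α ≠ ∞)
    {μΘ : Measure (Path d)} [SFinite μΘ] (hΘ : IsSpectralLaw π α μΘ)
    {F H : Path d → ℝ≥0∞} (hF : Measurable F)
    (hFH : ∀ z ∈ l0 d, ∑' k, (exceedsAtZero d).indicator F (shift k z) =
      {z | 1 < supNorm z}.indicator (fun z => H (normalize z)) z) :
    ∫⁻ y, F y ∂(paretoMixture α μΘ) =
      (coeffMass π id α)⁻¹ * ∫⁻ x, H (normalize x) * ENNReal.ofReal (supNorm x ^ α) ∂π := by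
  have hE := measurableSet_exceedsAtZero (d := d)
  have hFE := hF.indicator hE
  have hFc : Measurable fun p : Path d × Lattice d × ℝ =>
      (exceedsAtZero d).indicator F (cluster p) := hFE.comp measurable_cluster
  have h1 : coeffMass π id α * ∫⁻ y, F y ∂(paretoMixture α μΘ) =
      ∫⁻ x, H (normalize x) * ENNReal.ofReal (supNorm x ^ α) ∂π := by
    rw [← smul_eq_mul, ← lintegral_smul_measure, ← restrict_map_cluster hα hc0 hc1 hΘ,
      ← lintegral_indicator hE, lintegral_map hFE measurable_cluster,
      lintegral_clusterMeasure' hFc]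
    refine lintegral_congr_ae ?_
    filter_upwards [hπ] with x hx
    have hm : MeasurableSet {s : ℝ | 1 < s * supNorm x} :=
      measurableSet_lt (by fun_prop) (by fun_prop)
    have h2 : ∀ᵐ s ∂(radial α), ∑' k, (exceedsAtZero d).indicator F (cluster (x, k, s)) =
        {s : ℝ | 1 < s * supNorm x}.indicator (fun _ => H (normalize x)) s := by
      filter_upwards [ae_radial_pos α] with s hs
      refine (hFH (s • x) (smul_mem_l0 hx s)).trans ?_
      simp only [Set.indicator_apply, Set.mem_ofPred_eq, supNorm_smul hs.le, normalize_smul hs]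
    refine (lintegral_congr_ae h2).trans ?_
    rw [lintegral_indicator_const hm, radial_one_lt_mul hα (supNorm_nonneg x)]
  rw [← h1, ← mul_assoc, ENNReal.inv_mul_cancel hc0 hc1, one_mul]

/-! ### The extremal index -/

/-- Each of the |e(z)| exceedance points contributes 1/|e(z)|, as the count is shift-invariant. On
`l0` the count is finite, and it is nonzero exactly when ‖z‖ > 1. -/
lemma tsum_inv_encard {z : Path d} (hz : z ∈ l0 d) :
    ∑' k, (exceedsAtZero d).indicator (fun y => ((exceedances y).encard : ℝ≥0∞)⁻¹) (shift k z) =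
      {z | 1 < supNorm z}.indicator (fun _ => (1 : ℝ≥0∞)) z := by
  have h1 : ∀ k, (exceedsAtZero d).indicator (fun y => ((exceedances y).encard : ℝ≥0∞)⁻¹)
      (shift k z) = (exceedances z).indicator (fun _ => 1) k * ((exceedances z).encard : ℝ≥0∞)⁻¹ := by
    intro k
    by_cases hk : k ∈ exceedances z
    · rw [Set.indicator_of_mem (shift_mem_exceedsAtZero.2 hk), Set.indicator_of_mem hk, one_mul,
        encard_exceedances_shift]
    · rw [Set.indicator_of_notMem (mt shift_mem_exceedsAtZero.1 hk), Set.indicator_of_notMem hk,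
        zero_mul]
  simp only [h1]
  rw [ENNReal.tsum_mul_right, ← tsum_subtype, ENNReal.tsum_set_one]
  by_cases h : (exceedances z).Nonempty
  · rw [Set.indicator_of_mem (s := {z | 1 < supNorm z}) ((one_lt_supNorm_iff hz).2 h)]
    refine ENNReal.mul_inv_cancel ?_ ?_
    · simpa using h.ne_empty
    · simpa using finite_exceedances hz
  · rw [Set.indicator_of_notMem (s := {z | 1 < supNorm z}) (mt (one_lt_supNorm_iff hz).1 h),
      Set.not_nonempty_iff_eq_empty.1 h]
    simp

/-! ### Anchoring functions -/

lemma IsAnchoring.measurableSet {A : Path d → Lattice d} (hA : IsAnchoring A) :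
    MeasurableSet {y : Path d | y ∈ E0 d ∧ A y = 0} := by
  have h : {y : Path d | y ∈ E0 d ∧ A y = 0} =
      Subtype.val '' ((fun x : E0 d => A x) ⁻¹' {0}) := by
    ext y
    constructor
    · exact fun h => ⟨⟨y, h.1⟩, h.2, rfl⟩
    · rintro ⟨⟨y, hy⟩, h, rfl⟩
      exact ⟨hy, h⟩
  rw [h]
  exact measurableSet_E0.subtype_image (hA.measurable (measurableSet_singleton _))

/-- Viewed from any exceedance point j, the anchor sits at A(θ^j z) + j in the coordinates of z.
Covariance makes this site independent of j, and it is the only origin at which A vanishes. -/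
lemma IsAnchoring.existsUnique {A : Path d → Lattice d} (hA : IsAnchoring A) {z : Path d}
    (hz : z ∈ l0 d) (hne : (exceedances z).Nonempty) :
    ∃! k, shift k z ∈ E0 d ∧ A (shift k z) = 0 := by
  have hE : ∀ k, k ∈ exceedances z → shift k z ∈ E0 d := fun k hk => by
    refine ⟨by simpa [mem_exceedances_shift] using hk, ?_⟩
    rw [← Set.encard_lt_top_iff, encard_exceedances_shift, Set.encard_lt_top_iff]
    exact finite_exceedances hz
  obtain ⟨j, hj⟩ := hne
  have hy := hE j hj
  have hmem := hA.mem _ hy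
  refine ⟨A (shift j z) + j, ⟨hE _ hmem, ?_⟩, fun k hk => ?_⟩
  · have := hA.covariant _ hy _ hmem
    rw [shift_shift] at this
    simpa using this
  · have hk1 : k ∈ exceedances z := by simpa [mem_exceedances_shift] using hk.1.1
    have := hA.covariant _ hy (k - j) (by simpa [mem_exceedances_shift] using hk1)
    rw [shift_shift, sub_add_cancel, hk.2, zero_add] at this
    rw [← this, sub_add_cancel]

lemma IsAnchoring.tsum {A : Path d → Lattice d} (hA : IsAnchoring A) {h : Path d → ℝ≥0}
    (hh : ShiftInvariantOn h (l0 d)) {z : Path d} (hz : z ∈ l0 d) :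
    ∑' k, (exceedsAtZero d).indicator ({y : Path d | y ∈ E0 d ∧ A y = 0}.indicator
        fun y => (h (normalize y) : ℝ≥0∞)) (shift k z) =
      {z | 1 < supNorm z}.indicator (fun z => (h (normalize z) : ℝ≥0∞)) z := by
  set W : Set (Path d) := {y | y ∈ E0 d ∧ A y = 0} with hW
  have hWE : ∀ k, shift k z ∈ W → k ∈ exceedances z := fun k hk => by
    simpa [mem_exceedances_shift] using hk.1.1
  have h0 : ∀ k, shift k z ∉ W → (exceedsAtZero d).indicator (W.indicator
      fun y => (h (normalize y) : ℝ≥0∞)) (shift k z) = 0 := fun k hk => by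
    simp [Set.indicator, hk]
  by_cases hne : (exceedances z).Nonempty
  · obtain ⟨k, hk, huniq⟩ := hA.existsUnique hz hne
    rw [tsum_eq_single k fun j hj => h0 j fun hjW => hj (huniq j hjW),
      Set.indicator_of_mem (shift_mem_exceedsAtZero.2 (hWE k hk)),
      Set.indicator_of_mem (s := W) hk,
      Set.indicator_of_mem (s := {z | 1 < supNorm z}) ((one_lt_supNorm_iff hz).2 hne),
      normalize_shift, hh (normalize z) (smul_mem_l0 hz _)]
  · rw [Set.indicator_of_notMem (s := {z | 1 < supNorm z}) (mt (one_lt_supNorm_iff hz).1 hne)]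
    exact ENNReal.tsum_eq_zero.2 fun k => h0 k fun hk => hne ⟨k, hWE k hk⟩

/-- The lexicographically least exceedance point is an anchoring function. -/
lemma exists_isAnchoring (d : ℕ) : ∃ A : Path d → Lattice d, IsAnchoring A := by
  classical
  let L : Path d → Lattice d → Prop := fun x k =>
    k ∈ exceedances x ∧ ∀ j ∈ exceedances x, toLex k ≤ toLex j
  have hL : ∀ x ∈ E0 d, ∃ k, L x k := fun x hx =>
    Set.exists_min_image (exceedances x) toLex hx.2 ⟨0, hx.1⟩
  have huniq : ∀ x k j, L x k → L x j → k = j := fun x k j hk hj =>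
    toLex.injective (le_antisymm (hk.2 j hj.1) (hj.2 k hk.1))
  -- The default 0 is never used on `E0`, where finiteness and nonemptiness provide a minimum.
  let A : Path d → Lattice d := fun x => if h : ∃ k, L x k then h.choose else 0
  have hA : ∀ x ∈ E0 d, L x (A x) := fun x hx => by
    simp only [A, dif_pos (hL x hx)]
    exact (hL x hx).choose_spec
  refine ⟨A, ?_, fun x hx => (hA x hx).1, fun x hx k hk => ?_⟩
  · refine measurable_to_countable' fun k => ?_
    have h1 : (fun x : E0 d => A x) ⁻¹' {k} = Subtype.val ⁻¹' ({y : Path d | 1 < |y k|} ∩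
        ⋂ j : {j : Lattice d // ¬ toLex k ≤ toLex j}, {y : Path d | 1 < |y j|}ᶜ) := by
      ext ⟨x, hx⟩
      have h2 : A x = k ↔ L x k := ⟨fun h => h ▸ hA x hx, fun h => huniq x _ _ (hA x hx) h⟩
      refine h2.trans (and_congr Iff.rfl ?_)
      rw [Set.mem_iInter]
      exact ⟨fun h ⟨j, hj⟩ hj' => hj (h j hj'), fun h j hj => by_contra fun hlt => h ⟨j, hlt⟩ hj⟩
    rw [h1]
    exact measurable_subtype_coe ((measurableSet_exceeds k).inter
      (MeasurableSet.iInter fun j => (measurableSet_exceeds j.1).compl))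
  · have hkx : shift k x ∈ E0 d := by
      refine ⟨by simpa [mem_exceedances_shift] using hk, ?_⟩
      rw [← Set.encard_lt_top_iff, encard_exceedances_shift, Set.encard_lt_top_iff]
      exact hx.2
    have h1 := hA _ hkx
    refine huniq x _ _ ⟨h1.1, fun j hj => ?_⟩ (hA x hx)
    have h2 := h1.2 (j - k) (by simpa [mem_exceedances_shift] using hj)
    -- Covariance comes from the translation invariance of the lexicographic order.
    have h3 := add_le_add_left h2 (toLex k)
    rwa [← toLex_add, ← toLex_add, sub_add_cancel] at h3

/-! ### The anchored law -/

lemma normMoment_map {Ω : Type*} [MeasurableSpace Ω] {P : Measure Ω} {C : Ω → Path d}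
    (hC : Measurable C) {κ : Ω → ℝ} (hκ : Measurable κ) (hs : ∀ᵐ ω ∂P, κ ω = -1 ∨ κ ω = 1)
    (α : ℝ) : normMoment (P.map fun ω => κ ω • C ω) id α = normMoment P C α := by
  have hm : Measurable fun ω => κ ω • C ω := by fun_prop
  unfold normMoment
  rw [lintegral_map (by simp only [id]; fun_prop) hm]
  refine lintegral_congr_ae ?_
  filter_upwards [hs] with ω h
  have : supNorm (κ ω • C ω) = supNorm (C ω) := by
    unfold supNorm
    rcases h with h | h <;> simp [h]
  simp [this]

/-- The formula on sets exhibits the law of Q as a normalised image, under x ↦ x/‖x‖, of π weighted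
by ‖x‖^α. -/
lemma IsMAAnchoredLaw.lintegral {Ω : Type*} [MeasurableSpace Ω] {P : Measure Ω}
    {C : Ω → Path d} (hC : Measurable C) {κ : Ω → ℝ} (hκ : Measurable κ)
    (hs : ∀ᵐ ω ∂P, κ ω = -1 ∨ κ ω = 1) {α : ℝ} {μQ : Measure (Path d)}
    (h : IsMAAnchoredLaw P C κ α μQ) {g : Path d → ℝ≥0∞} (hg : Measurable g) :
    ∫⁻ q, g q ∂μQ = (normMoment P C α)⁻¹ *
      ∫⁻ x, g (normalize x) * ENNReal.ofReal (supNorm x ^ α) ∂(P.map fun ω => κ ω • C ω) := by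
  have hm : Measurable fun ω => κ ω • C ω := by fun_prop
  set π := P.map fun ω => κ ω • C ω with hπ
  have hw : Measurable fun x : Path d => ENNReal.ofReal (supNorm x ^ α) := by fun_prop
  have hQ : μQ = (normMoment P C α)⁻¹ •
      (π.withDensity fun x => ENNReal.ofReal (supNorm x ^ α)).map normalize := by
    ext B hB
    rw [h B hB, Measure.smul_apply, smul_eq_mul, Measure.map_apply measurable_normalize hB,
      withDensity_apply _ (measurable_normalize hB),
      ← lintegral_indicator (measurable_normalize hB), hπ,
      lintegral_map (hw.indicator (measurable_normalize hB)) hm]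
    congr 1
    refine lintegral_congr_ae ?_
    filter_upwards [hs] with ω h
    have h1 : supNorm (κ ω • C ω) = supNorm (C ω) := by
      unfold supNorm
      rcases h with h | h <;> simp [h]
    have h2 : normalize (κ ω • C ω) = (κ ω / supNorm (C ω)) • C ω := by
      rw [normalize, h1, smul_smul, div_eq_inv_mul]
    by_cases hb : normalize (κ ω • C ω) ∈ B
    · rw [Set.indicator_of_mem (s := normalize ⁻¹' B) hb, ← h2, Set.indicator_of_mem hb, one_mul, h1]
    · rw [Set.indicator_of_notMem (s := normalize ⁻¹' B) hb, ← h2, Set.indicator_of_notMem hb,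
        zero_mul]
  rw [hQ, lintegral_smul_measure, lintegral_map hg measurable_normalize,
    smul_eq_mul]
  congr 1
  refine (lintegral_withDensity_eq_lintegral_mul _ hw (hg.comp measurable_normalize)).trans ?_
  simp only [Pi.mul_apply, Function.comp_apply, mul_comm]

/-- The orbit-sum formula is applied to h and to the constant 1. The latter gives P(A(Y) = 0) =
E‖C‖^α / c, so c cancels in the conditional expectation and the result does not depend on A. -/
lemma representsAnchor_of_spectralLaw {π : Measure (Path d)} [SFinite π]
    (hπ : ∀ᵐ x ∂π, x ∈ l0 d) {α : ℝ} (hα : 0 < α)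
    (hc0 : coeffMass π id α ≠ 0) (hc1 : coeffMass π id α ≠ ∞)
    {μΘ : Measure (Path d)} [SFinite μΘ] (hΘ : IsSpectralLaw π α μΘ)
    {μQ : Measure (Path d)}
    (hQ : ∀ g : Path d → ℝ≥0∞, Measurable g → ∫⁻ q, g q ∂μQ = (normMoment π id α)⁻¹ *
      ∫⁻ x, g (normalize x) * ENNReal.ofReal (supNorm x ^ α) ∂π)
    {A : Path d → Lattice d} (hA : IsAnchoring A) :
    RepresentsAnchor A (paretoMixture α μΘ) μQ := by
  intro h hm hinv
  have hW := hA.measurableSet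
  set W : Set (Path d) := {y | y ∈ E0 d ∧ A y = 0}
  have key : ∀ g : Path d → ℝ≥0, Measurable g → ShiftInvariantOn g (l0 d) →
      ∫⁻ y in W, (g (normalize y) : ℝ≥0∞) ∂(paretoMixture α μΘ) = (coeffMass π id α)⁻¹ *
        ∫⁻ x, g (normalize x) * ENNReal.ofReal (supNorm x ^ α) ∂π := by
    intro g hg hginv
    rw [← lintegral_indicator hW]
    exact lintegral_paretoMixture_of_orbit_sum (H := fun z => (g z : ℝ≥0∞)) hπ hα hc0 hc1 hΘ
      (Measurable.indicator (by fun_prop) hW) fun z hz => hA.tsum hginv hz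
  have h1 := key (fun _ => 1) measurable_const fun _ _ _ => rfl
  simp only [ENNReal.coe_one, lintegral_one, one_mul, Measure.restrict_apply_univ] at h1
  have hM : ∫⁻ x, ENNReal.ofReal (supNorm x ^ α) ∂π = normMoment π id α := rfl
  have h2 : ∫⁻ z, (h ((supNorm z)⁻¹ • z) : ℝ≥0∞) ∂(anchoredLaw A (paretoMixture α μΘ)) =
      (paretoMixture α μΘ W)⁻¹ * ∫⁻ y in W, (h (normalize y) : ℝ≥0∞) ∂(paretoMixture α μΘ) := by
    rw [anchoredLaw, ProbabilityTheory.cond, lintegral_smul_measure]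
    rfl
  -- The cancellation in `ℝ≥0∞` needs only c to be nonzero and finite, with no separate condition on
  -- E‖C‖^α.
  have hci0 : (coeffMass π id α)⁻¹ ≠ 0 := ENNReal.inv_ne_zero.2 hc1
  have hci1 : (coeffMass π id α)⁻¹ ≠ ∞ := ENNReal.inv_ne_top.2 hc0
  rw [hQ _ (by fun_prop), h2, key h hm hinv, h1, hM, ENNReal.mul_inv (Or.inl hci0) (Or.inl hci1),
    inv_inv, mul_comm (coeffMass π id α), mul_assoc, ← mul_assoc (coeffMass π id α),
    ENNReal.mul_inv_cancel hc0 hc1, one_mul]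

lemma extremalIndex_of_spectralLaw {π : Measure (Path d)} [SFinite π]
    (hπ : ∀ᵐ x ∂π, x ∈ l0 d) {α : ℝ} (hα : 0 < α)
    (hc0 : coeffMass π id α ≠ 0) (hc1 : coeffMass π id α ≠ ∞)
    {μΘ : Measure (Path d)} [SFinite μΘ] (hΘ : IsSpectralLaw π α μΘ) :
    extremalIndex (paretoMixture α μΘ) = normMoment π id α / coeffMass π id α := by
  have hF : Measurable fun y : Path d => ((exceedances y).encard : ℝ≥0∞)⁻¹ :=
    measurable_encard_exceedances.inv
  rw [extremalIndex, lintegral_paretoMixture_of_orbit_sum (H := fun _ => 1) hπ hα hc0 hc1 hΘ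
    hF fun z hz => tsum_inv_encard hz, ENNReal.div_eq_inv_mul]
  simp [normMoment]

end TailField

/-! ### The proposition, with π the law of κC -/

theorem mainTheorem7 {d : ℕ} (hd : 1 ≤ d)
    {Ω : Type*} [MeasurableSpace Ω] (P : Measure Ω) [IsProbabilityMeasure P]
    (C : Ω → TailField.Path d) (hC : Measurable C) (hC0 : ∀ᵐ ω ∂P, C ω ∈ TailField.l0 d)
    (α : ℝ) (hα : 0 < α)
    (hc_pos : 0 < TailField.coeffMass P C α) (hc_lt : TailField.coeffMass P C α < ∞)
    (κ : Ω → ℝ) (hκ : Measurable κ) (hκ_sign : ∀ᵐ ω ∂P, κ ω = -1 ∨ κ ω = 1)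
    (hind : IndepFun C κ P) :
    -- (i)
    (∀ {Ω₁ : Type*} [MeasurableSpace Ω₁] (P₁ : Measure Ω₁) [IsProbabilityMeasure P₁]
        (Θ : Ω₁ → TailField.Path d), Measurable Θ → (∀ᵐ ω ∂P₁, Θ ω ∈ TailField.l0 d) →
        TailField.IsMASpectralLaw P C κ α (P₁.map Θ) →
        TailField.IsSpectralTailProcess α (P₁.map Θ)) ∧
    -- (ii)
    (∀ {Ω₂ : Type*} [MeasurableSpace Ω₂] (P₂ : Measure Ω₂) [IsProbabilityMeasure P₂]
        (Y : Ω₂ → TailField.Path d), Measurable Y → (∀ᵐ ω ∂P₂, Y ω ∈ TailField.l0 d) →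
        TailField.IsTailProcess α (P₂.map Y) →
        TailField.IsMASpectralLaw P C κ α (P₂.map (fun ω => TailField.spectral (Y ω))) →
        (∀ {Ω₃ : Type*} [MeasurableSpace Ω₃] (P₃ : Measure Ω₃) [IsProbabilityMeasure P₃]
            (Q : Ω₃ → TailField.Path d), Measurable Q → (∀ᵐ ω ∂P₃, Q ω ∈ TailField.l0 d) →
            TailField.IsMAAnchoredLaw P C κ α (P₃.map Q) →
            TailField.IsAnchoredSpectralRepresentative (P₂.map Y) (P₃.map Q)) ∧
        TailField.extremalIndex (P₂.map Y) =
          TailField.normMoment P C α / TailField.coeffMass P C α) := by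
  have hm : Measurable fun ω => κ ω • C ω := by fun_prop
  have hc := TailField.coeffMass_map hC hκ hκ_sign α
  have hM := TailField.normMoment_map hC hκ hκ_sign α
  have hπ : IsProbabilityMeasure (P.map fun ω => κ ω • C ω) :=
    Measure.isProbabilityMeasure_map hm.aemeasurable
  have hπ0 : ∀ᵐ x ∂(P.map fun ω => κ ω • C ω), x ∈ TailField.l0 d := by
    refine (ae_map_iff hm.aemeasurable TailField.measurableSet_l0).2 ?_
    filter_upwards [hC0] with ω hω using TailField.smul_mem_l0 hω _
  have hc0 := hc_pos.ne'
  have hc1 := hc_lt.ne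
  rw [← hc] at hc0 hc1
  refine ⟨fun P₁ _ Θ hΘm _ hΘ => ?_, fun P₂ _ Y hY _ hT hΘ => ?_⟩
  · have := Measure.isProbabilityMeasure_map (μ := P₁) hΘm.aemeasurable
    exact TailField.isSpectralTailProcess_of_isSpectralLaw hd hα hc0 hc1
      (hΘ.isSpectralLaw hC hκ hκ_sign)
  · have hYp := Measure.isProbabilityMeasure_map (μ := P₂) hY.aemeasurable
    have h1 : P₂.map (fun ω => TailField.spectral (Y ω)) = (P₂.map Y).map TailField.spectral :=
      (Measure.map_map TailField.measurable_spectral hY).symm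
    rw [h1] at hΘ
    have h2 := hΘ.isSpectralLaw hC hκ hκ_sign
    have h3 := hT.eq_paretoMixture hα
    refine ⟨fun P₃ _ Q hQm hQ0 hQ => ?_, ?_⟩
    · have hrep : ∀ A : TailField.Path d → TailField.Lattice d, TailField.IsAnchoring A →
          TailField.RepresentsAnchor A (P₂.map Y) (P₃.map Q) := by
        intro A hA
        rw [h3]
        refine TailField.representsAnchor_of_spectralLaw hπ0 hα hc0 hc1 h2 ?_ hA
        intro g hg
        rw [hQ.lintegral hC hκ hκ_sign hg, hM]
      obtain ⟨A, hA⟩ := TailField.exists_isAnchoring d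
      exact ⟨(ae_map_iff hQm.aemeasurable TailField.measurableSet_l0).2 hQ0,
        ⟨A, hA, hrep A hA⟩, hrep⟩
    · rw [h3, TailField.extremalIndex_of_spectralLaw hπ0 hα hc0 hc1 h2, hc, hM]
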